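/- Let $I=[0,1]$ with Lebesgue measure $\lambda$, and for $f\colon I\to I$ and $t\in I$ let $$D^{\pm}f(t)=\limsup_{x\to t^{\pm},\,x\in I}\frac{f(x)-f(t)}{x-t},\qquad D_{\pm}f(t)=\liminf_{x\to t^{\pm},\,x\in I}\frac{f(x)-f(t)}{x-t}$$ be the Dini derivatives, with values in $[-\infty,\infty]$. There is a continuous map $f$ of $I$ onto $I$ with $\lambda(f^{-1}(A))=\lambda(A)$ for every Borel set $A\subseteq I$ such that: (a) ($f$ is a Besicovitch function) $f$ has no finite or infinite one-sided derivative at any point: $D^+f(t)\neq D_+f(t)$ for every $t\in[0,1)$ and $D^-f(t)\neq D_-f(t)$ for every $t\in(0,1]$; (b) ($f$ is a Morse function) $\max\{|D^+f(t)|,|D_+f(t)|\}=\infty$ for every $t\in[0,1)$ and $\max\{|D^-f(t)|,|D_-f(t)|\}=\infty$ for every $t\in(0,1]$. -/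

import Mathlib

open Set Filter Topology MeasureTheory

/-- The set `C(λ)` of continuous maps of `I = [0,1]` onto itself that preserve Lebesgue measure
(`volume` on `unitInterval` is the restriction of Lebesgue measure to `[0,1]`). -/
def LebesguePreservingMaps : Set (unitInterval → unitInterval) :=
  {f | Continuous f ∧ Function.Surjective f ∧
    ∀ A : Set unitInterval, MeasurableSet A → volume A = volume (f ⁻¹' A)}

/-- The difference quotient `(f x - f t) / (x - t)` as an extended real number; only its values
at `x ≠ t` are ever used. -/
noncomputable def diffQuot (f : unitInterval → ℝ) (t x : unitInterval) : EReal :=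
  (((f x - f t) / ((x : ℝ) - (t : ℝ)) : ℝ) : EReal)

/-- The upper right Dini derivative `D⁺f(t)`; the filter is `x → t`, `x > t`, `x ∈ [0,1]`. -/
noncomputable def diniUpperRight (f : unitInterval → ℝ) (t : unitInterval) : EReal :=
  limsup (diffQuot f t) (𝓝[>] t)

/-- The lower right Dini derivative `D₊f(t)`. -/
noncomputable def diniLowerRight (f : unitInterval → ℝ) (t : unitInterval) : EReal :=
  liminf (diffQuot f t) (𝓝[>] t)

/-- The upper left Dini derivative `D⁻f(t)`; the filter is `x → t`, `x < t`, `x ∈ [0,1]`. -/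
noncomputable def diniUpperLeft (f : unitInterval → ℝ) (t : unitInterval) : EReal :=
  limsup (diffQuot f t) (𝓝[<] t)

/-- The lower left Dini derivative `D₋f(t)`. -/
noncomputable def diniLowerLeft (f : unitInterval → ℝ) (t : unitInterval) : EReal :=
  liminf (diffQuot f t) (𝓝[<] t)

/-- `f` has a finite or infinite right derivative at `t` (which makes sense only for `t < 1`). -/
def HasRightDerivative (f : unitInterval → ℝ) (t : unitInterval) : Prop :=
  t < 1 ∧ diniUpperRight f t = diniLowerRight f t

/-- `f` has a finite or infinite left derivative at `t` (which makes sense only for `0 < t`). -/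
def HasLeftDerivative (f : unitInterval → ℝ) (t : unitInterval) : Prop :=
  0 < t ∧ diniUpperLeft f t = diniLowerLeft f t

/-- A Besicovitch function: continuous, and at no point is there a finite or infinite one-sided
derivative. -/
def IsBesicovitchFunction (f : unitInterval → ℝ) : Prop :=
  Continuous f ∧ ∀ t, ¬ HasRightDerivative f t ∧ ¬ HasLeftDerivative f t

/-- A Morse function: continuous, with
`max {|D⁺f(t)|, |D₊f(t)|} = max {|D⁻f(t)|, |D₋f(t)|} = ∞` for all `t`, where the right term is
skipped at `t = 1` and the left term at `t = 0`. -/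
def IsMorseFunction (f : unitInterval → ℝ) : Prop :=
  Continuous f ∧ ∀ t : unitInterval,
    (t < 1 → max (diniUpperRight f t).abs (diniLowerRight f t).abs = ⊤) ∧
    (0 < t → max (diniUpperLeft f t).abs (diniLowerLeft f t).abs = ⊤)

/-! The function is self-similar: an increasing map, constant on countably many disjoint intervals
whose levels `v i` are dense, carries over the `i`-th interval a spike of width `g i` and signed
height `H i`. The spike climbs from `v i` to `v i + H i` along an affine copy of the function itself
and returns along a mirrored copy. Since `|H i| ≤ 1/2`, the operator that inserts two copies of a
function into every spike is a contraction, and its fixed point is the function sought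
(`exists_fixed`).

Lebesgue measure is preserved because the increasing part is chosen to compensate for the spikes. If
the copies are equidistributed, the `i`-th spike contributes `g i * fill i y` to the measure of `{f
≤ y}`; the formulas for `lower` and `upper` subtract this amount. The true distribution function
then has a defect that reproduces itself inside the spikes with total weight `∑ g i ≤ 1/2`, hence it
is zero (`subMeasure_eq`).

Oscillation to the right of `t` has two sources. At `t = upper y`, the points of the increasing part
give bounded quotients, while spikes that are tall compared with their distance and with all widths
up to them give unbounded ones (`rightOscillating_upper`). Every other `t < 1` lies in the half-open
half of a spike, and oscillation passes through the affine copy. A bad point is therefore nested in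
spikes of all generations. There the ratio of height to width grows at least like `2 ^ n`, so the
quotients are unbounded. If they tended to an infinite limit, `f` would stay on one side of `f t` to
the right of `t`; `not_forall_lt` excludes this, since a neighbouring spike reaches almost as far as
the one containing `t`. The left side follows by reflection at the centre of the square. -/

/-- Near `t`, to the right, the difference quotients of `f` are unbounded, but converge neither to
`∞` nor to `-∞`. -/
def RightOscillating (f : ℝ → ℝ) (t : ℝ) : Prop :=
  (∀ A δ : ℝ, 0 < δ → ∃ x, t < x ∧ x < t + δ ∧ A * (x - t) ≤ |f x - f t|) ∧
  (∃ C : ℝ, ∀ δ, 0 < δ → ∃ x, t < x ∧ x < t + δ ∧ f x - f t ≤ C * (x - t)) ∧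
  (∃ C : ℝ, ∀ δ, 0 < δ → ∃ x, t < x ∧ x < t + δ ∧ C * (x - t) ≤ f x - f t)

/-! ### Spike systems, spike functions and their reflection -/

/-- Positions `v`, signed heights `H` and widths `g` of the spikes of a spike function. -/
structure SpikeSystem (ι : Type*) where
  v : ι → ℝ
  g : ι → ℝ
  H : ι → ℝ
  v_pos : ∀ i, 0 < v i
  v_lt_one : ∀ i, v i < 1
  v_injective : Function.Injective v
  g_pos : ∀ i, 0 < g i
  H_ne : ∀ i, H i ≠ 0
  H_tendsto : Tendsto H cofinite (𝓝 0)
  summable_ratio : Summable fun i => g i / |H i|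
  tsum_ratio_le : ∑' i, g i / |H i| ≤ 1 / 2
  summable_left : Summable fun i => g i / v i
  summable_right : Summable fun i => g i / (1 - v i)
  range_low : ∀ i, v i / 2 ≤ v i + H i
  range_high : ∀ i, (1 - v i) / 2 ≤ 1 - (v i + H i)
  spike_right : ∀ y, 0 ≤ y → y < 1 → ∀ A δ₀ : ℝ, 0 < δ₀ →
    ∃ δ, 0 < δ ∧ δ < δ₀ ∧ ∃ j, y < v j ∧ v j ≤ y + δ ∧ A * δ ≤ |H j|
  spike_left : ∀ y, 0 < y → y ≤ 1 → ∀ A δ₀ : ℝ, 0 < δ₀ →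
    ∃ δ, 0 < δ ∧ δ < δ₀ ∧ ∃ j, v j < y ∧ y - δ ≤ v j ∧ A * δ ≤ |H j|
  low_of_neg : ∀ i, H i < 0 → 1 / 4 ≤ v i + H i
  high_of_pos : ∀ i, 0 < H i → v i + H i ≤ 3 / 4
  cover_right : ∀ i, H i < 0 → ∃ j, v i < v j ∧ v j + H j ≤ v i + 3 / 4 * H i
  cover_left : ∀ i, 0 < H i → ∃ j, v j < v i ∧ v i + 3 / 4 * H i ≤ v j + H j

namespace SpikeSystem

variable {ι : Type*} (S : SpikeSystem ι)

lemma abs_H_pos (i : ι) : 0 < |S.H i| := abs_pos.2 (S.H_ne i)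

lemma abs_H_le (i : ι) : |S.H i| ≤ 1 / 2 := by
  have h1 := S.range_low i
  have h2 := S.range_high i
  have h3 := S.v_pos i
  have h4 := S.v_lt_one i
  rw [abs_le]
  constructor <;> linarith

lemma ratio_pos (i : ι) : 0 < S.g i / |S.H i| := div_pos (S.g_pos i) (S.abs_H_pos i)

lemma g_eq (i : ι) : S.g i = |S.H i| * (S.g i / |S.H i|) := by
  have := S.abs_H_pos i
  field_simp

lemma g_le_ratio (i : ι) : S.g i ≤ S.g i / |S.H i| / 2 := by
  have h := mul_le_mul_of_nonneg_right (S.abs_H_le i) (S.ratio_pos i).le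
  rw [← S.g_eq i] at h
  linarith

lemma summable_g : Summable S.g :=
  Summable.of_nonneg_of_le (fun i => (S.g_pos i).le) S.g_le_ratio (S.summable_ratio.div_const 2)

lemma g_le_abs_H (i : ι) : S.g i ≤ |S.H i| / 2 := by
  have h : S.g i / |S.H i| ≤ 1 / 2 :=
    (S.summable_ratio.le_tsum i fun j _ => (S.ratio_pos j).le).trans S.tsum_ratio_le
  have h2 := mul_le_mul_of_nonneg_left h (S.abs_H_pos i).le
  rw [← S.g_eq i] at h2
  linarith

/-- The reflection of a spike system at the centre of the unit square. -/
def flip : SpikeSystem ι where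
  v i := 1 - S.v i
  g := S.g
  H i := -S.H i
  v_pos i := by linarith [S.v_lt_one i]
  v_lt_one i := by linarith [S.v_pos i]
  v_injective i j h := S.v_injective (by simpa using h)
  g_pos := S.g_pos
  H_ne i := neg_ne_zero.2 (S.H_ne i)
  H_tendsto := by simpa using S.H_tendsto.neg
  summable_ratio := by simpa using S.summable_ratio
  tsum_ratio_le := by simpa using S.tsum_ratio_le
  summable_left := S.summable_right
  summable_right := by simpa using S.summable_left
  range_low i := by linarith [S.range_high i]
  range_high i := by linarith [S.range_low i]
  spike_right y h0 h1 A δ₀ hδ := by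
    obtain ⟨δ, hδ, hδ', j, h2, h3, h4⟩ := S.spike_left (1 - y) (by linarith) (by linarith) A δ₀ hδ
    exact ⟨δ, hδ, hδ', j, by linarith, by linarith, by simpa using h4⟩
  spike_left y h0 h1 A δ₀ hδ := by
    obtain ⟨δ, hδ, hδ', j, h2, h3, h4⟩ := S.spike_right (1 - y) (by linarith) (by linarith) A δ₀ hδ
    exact ⟨δ, hδ, hδ', j, by linarith, by linarith, by simpa using h4⟩
  low_of_neg i h := by linarith [S.high_of_pos i (by linarith)]
  high_of_pos i h := by linarith [S.low_of_neg i (by linarith)]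
  cover_right i h := by
    obtain ⟨j, h1, h2⟩ := S.cover_left i (by linarith)
    exact ⟨j, by linarith, by linarith⟩
  cover_left i h := by
    obtain ⟨j, h1, h2⟩ := S.cover_right i (by linarith)
    exact ⟨j, by linarith, by linarith⟩

/-- `f` follows the increasing function whose (multivalued) inverse is bounded by `lower` and
`upper`, and has over the `i`-th jump of that inverse a spike made of two scaled copies of `f`. -/
structure IsSpikeFunction (f lower upper : ℝ → ℝ) : Prop where
  f_zero : f 0 = 0
  f_one : f 1 = 1
  f_mem : ∀ x ∈ Icc (0 : ℝ) 1, f x ∈ Icc (0 : ℝ) 1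
  bound : ∃ c, 0 < c ∧ ∀ x ∈ Icc (0 : ℝ) 1, c * x ≤ f x ∧ c * (1 - x) ≤ 1 - f x
  f_upper : ∀ y ∈ Icc (0 : ℝ) 1, f (upper y) = y
  f_lower : ∀ y ∈ Icc (0 : ℝ) 1, f (lower y) = y
  upper_v : ∀ i, upper (S.v i) = lower (S.v i) + S.g i
  upper_eq_lower : ∀ y, y ∉ range S.v → upper y = lower y
  lower_zero : lower 0 = 0
  upper_one : upper 1 = 1
  le_gap : ∀ y z, y < z → (z - y) / 2 ≤ lower z - upper y
  gap_le : ∀ y z, y < z → lower z - upper y ≤ z - y + ∑' i, (S.v ⁻¹' Ioo y z).indicator S.g i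
  left_piece : ∀ i, ∀ s ∈ Icc (0 : ℝ) 1,
    f (lower (S.v i) + S.g i / 2 * s) = S.v i + S.H i * f s
  right_piece : ∀ i, ∀ s ∈ Icc (0 : ℝ) 1,
    f (lower (S.v i) + S.g i / 2 + S.g i / 2 * s) = S.v i + S.H i * (1 - f s)
  cover : ∀ x ∈ Icc (0 : ℝ) 1, (∃ y ∈ Icc (0 : ℝ) 1, x = lower y ∨ x = upper y) ∨
    ∃ i, lower (S.v i) < x ∧ x < lower (S.v i) + S.g i

variable {S} {f lower upper : ℝ → ℝ}

/-- The point reflection exchanges `lower` with `upper` and the two halves of each spike. It turns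
results about right difference quotients into results about left ones. -/
lemma IsSpikeFunction.flip (h : S.IsSpikeFunction f lower upper) :
    S.flip.IsSpikeFunction (fun x => 1 - f (1 - x)) (fun y => 1 - upper (1 - y))
      (fun y => 1 - lower (1 - y)) where
  f_zero := by simp [h.f_one]
  f_one := by simp [h.f_zero]
  f_mem x hx := by
    have := h.f_mem (1 - x) ⟨by linarith [hx.2], by linarith [hx.1]⟩
    exact ⟨by linarith [this.2], by linarith [this.1]⟩
  bound := by
    obtain ⟨c, hc, hb⟩ := h.bound
    refine ⟨c, hc, fun x hx => ?_⟩
    have := hb (1 - x) ⟨by linarith [hx.2], by linarith [hx.1]⟩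
    simp only [sub_sub_cancel] at this ⊢
    exact ⟨this.2, this.1⟩
  f_upper y hy := by
    simp [h.f_lower (1 - y) ⟨by linarith [hy.2], by linarith [hy.1]⟩]
  f_lower y hy := by
    simp [h.f_upper (1 - y) ⟨by linarith [hy.2], by linarith [hy.1]⟩]
  upper_v i := by simp [SpikeSystem.flip, h.upper_v]; ring
  upper_eq_lower y hy := by
    rw [h.upper_eq_lower (1 - y)]
    rintro ⟨i, hi⟩
    exact hy ⟨i, by simp [SpikeSystem.flip, hi]⟩
  lower_zero := by simp [h.upper_one]
  upper_one := by simp [h.lower_zero]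
  le_gap y z hyz := by linarith [h.le_gap (1 - z) (1 - y) (by linarith)]
  gap_le y z hyz := by
    have h1 := h.gap_le (1 - z) (1 - y) (by linarith)
    have h2 : S.flip.v ⁻¹' Ioo y z = S.v ⁻¹' Ioo (1 - z) (1 - y) := by
      ext i
      simp only [SpikeSystem.flip, mem_preimage, mem_Ioo]
      constructor <;> rintro ⟨h1, h2⟩ <;> constructor <;> linarith
    rw [h2]
    have h3 : S.flip.g = S.g := rfl
    rw [h3]
    linarith
  left_piece i s hs := by
    have h1 := h.right_piece i (1 - s) ⟨by linarith [hs.2], by linarith [hs.1]⟩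
    simp only [SpikeSystem.flip, sub_sub_cancel, h.upper_v]
    rw [show 1 - (1 - (lower (S.v i) + S.g i) + S.g i / 2 * s) =
      lower (S.v i) + S.g i / 2 + S.g i / 2 * (1 - s) by ring, h1]
    ring
  right_piece i s hs := by
    have h1 := h.left_piece i (1 - s) ⟨by linarith [hs.2], by linarith [hs.1]⟩
    simp only [SpikeSystem.flip, sub_sub_cancel, h.upper_v]
    rw [show 1 - (1 - (lower (S.v i) + S.g i) + S.g i / 2 + S.g i / 2 * s) =
      lower (S.v i) + S.g i / 2 * (1 - s) by ring, h1]
    ring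
  cover x hx := by
    rcases h.cover (1 - x) ⟨by linarith [hx.2], by linarith [hx.1]⟩ with ⟨y, hy, h1⟩ | ⟨i, h1, h2⟩
    · refine Or.inl ⟨1 - y, ⟨by linarith [hy.2], by linarith [hy.1]⟩, ?_⟩
      simp only [sub_sub_cancel]
      rcases h1 with h1 | h1
      · right; linarith
      · left; linarith
    · refine Or.inr ⟨i, ?_, ?_⟩ <;> simp only [SpikeSystem.flip, sub_sub_cancel, h.upper_v] <;>
        linarith

/-- In a short interval to the right of `y` the sum of the values of a summable family indexed by
points of this interval is small. -/
lemma exists_window_tsum_le {ι : Type*} {γ v : ι → ℝ} (h0 : ∀ i, 0 ≤ γ i) (hγ : Summable γ) (y : ℝ)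
    {ε : ℝ} (hε : 0 < ε) :
    ∃ δ > 0, ∀ s : Set ι, s ⊆ v ⁻¹' Ioc y (y + δ) → ∑' i, s.indicator γ i ≤ ε := by
  -- Outside the finite set `F` the family sums to less than `ε`; the window is made short enough to
  -- miss the finitely many `v i > y` with `i ∈ F`.
  obtain ⟨F, hF⟩ := ((tendsto_order.1 (tendsto_tsum_compl_atTop_zero γ)).2 ε hε).exists
  have h1 : ∀ᶠ δ in 𝓝[>] (0 : ℝ), ∀ i ∈ F, y < v i → y + δ < v i := by
    rw [Finset.eventually_all]
    intro i _
    by_cases hi : y < v i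
    · have : ∀ᶠ δ in 𝓝 (0 : ℝ), δ < v i - y := eventually_lt_nhds (by linarith)
      filter_upwards [this.filter_mono nhdsWithin_le_nhds] with δ hδ _
      linarith
    · exact Eventually.of_forall fun δ h => absurd h hi
  obtain ⟨δ, hδ, hδ0⟩ := (h1.and self_mem_nhdsWithin).exists
  refine ⟨δ, hδ0, fun s hs => ?_⟩
  have hF : ∑' i, ({i | i ∉ F} : Set ι).indicator γ i < ε := by
    rwa [← tsum_subtype]
  refine le_trans (Summable.tsum_le_tsum ?_ (hγ.indicator _) (hγ.indicator _)) hF.le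
  refine fun i => indicator_le_indicator_of_subset ?_ h0 i
  intro i hi hiF
  have := hs hi
  exact absurd (hδ i hiF this.1) (not_lt.2 this.2)

end SpikeSystem

/-! ### Oscillation of spike functions at every point -/

namespace SpikeSystem
variable {ι : Type*} {S : SpikeSystem ι} {f lower upper : ℝ → ℝ}

namespace IsSpikeFunction

lemma upper_zero (h : S.IsSpikeFunction f lower upper) : upper 0 = 0 := by
  rw [h.upper_eq_lower 0, h.lower_zero]
  rintro ⟨i, hi⟩
  exact (S.v_pos i).ne' hi

lemma lower_nonneg (h : S.IsSpikeFunction f lower upper) {y : ℝ} (hy : 0 ≤ y) : 0 ≤ lower y := by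
  rcases hy.eq_or_lt with rfl | hy
  · exact h.lower_zero.ge
  · have := h.le_gap 0 y hy
    rw [h.upper_zero] at this
    linarith

lemma upper_le_one (h : S.IsSpikeFunction f lower upper) {y : ℝ} (hy : y ≤ 1) : upper y ≤ 1 := by
  rcases hy.eq_or_lt with rfl | hy
  · exact h.upper_one.le
  · have h1 := h.le_gap y 1 hy
    have h2 := h.upper_one
    rw [h.upper_eq_lower 1] at h2
    · linarith
    · rintro ⟨i, hi⟩
      exact (S.v_lt_one i).ne hi

lemma upper_v_le_one (h : S.IsSpikeFunction f lower upper) (i : ι) :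
    lower (S.v i) + S.g i ≤ 1 := by
  rw [← h.upper_v]
  exact h.upper_le_one (S.v_lt_one i).le

lemma f_right_end (h : S.IsSpikeFunction f lower upper) (i : ι) :
    f (lower (S.v i) + S.g i) = S.v i := by
  have := h.right_piece i 1 (by simp)
  rw [h.f_one] at this
  convert this using 2 <;> ring

lemma f_middle (h : S.IsSpikeFunction f lower upper) (i : ι) :
    f (lower (S.v i) + S.g i / 2) = S.v i + S.H i := by
  have := h.left_piece i 1 (by simp)
  rw [h.f_one] at this
  convert this using 2 <;> ring

/-- Level points `lower z` with `z ↓ y` have quotients between `0` and `2` by `le_gap`, which serves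
both one-sided bounds. Large quotients come from the tip of the tallest spike in a short window
above `y`: as no spike in the window is taller, the widths up to it are negligible against its
height. -/
lemma rightOscillating_upper (h : S.IsSpikeFunction f lower upper) {y : ℝ} (h0 : 0 ≤ y)
    (h1 : y < 1) : RightOscillating f (upper y) := by
  have key : ∀ δ, 0 < δ → ∃ z, y < z ∧ z ≤ 1 ∧ lower z < upper y + δ := by
    intro δ hδ
    obtain ⟨η, hη, hw⟩ := exists_window_tsum_le (v := S.v) (fun i => (S.g_pos i).le) S.summable_g y
      (half_pos hδ)
    refine ⟨y + min η (min (δ / 4) (1 - y)), ?_, ?_, ?_⟩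
    · have : 0 < min η (min (δ / 4) (1 - y)) := by
        simp only [lt_min_iff]; exact ⟨hη, by linarith, by linarith⟩
      linarith
    · have := (min_le_right η (min (δ / 4) (1 - y))).trans (min_le_right _ _)
      linarith
    · have a0 : 0 < min η (min (δ / 4) (1 - y)) := by
        simp only [lt_min_iff]; exact ⟨hη, by linarith, by linarith⟩
      have a1 := (min_le_right η (min (δ / 4) (1 - y))).trans (min_le_left _ _)
      have a2 := min_le_left η (min (δ / 4) (1 - y))
      have a3 := h.gap_le y (y + min η (min (δ / 4) (1 - y))) (by linarith)
      have a4 := hw (S.v ⁻¹' Ioo y (y + min η (min (δ / 4) (1 - y))))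
        (preimage_mono fun x hx => ⟨hx.1, by linarith [hx.2]⟩)
      linarith
  have fy := h.f_upper y ⟨h0, h1.le⟩
  refine ⟨?_, ⟨2, ?_⟩, ⟨0, ?_⟩⟩
  · intro A δ₀ hδ₀
    -- The tip will be at distance at most `3 * ε * |H i|` and at height difference at least `(1 -
    -- ε) * |H i|`. The first bound on `ε` makes the quotient exceed `A`; the second keeps the tip
    -- within `δ₀`, as `|H i| ≤ 1/2`.
    obtain ⟨ε, hε, hε1, hε2⟩ : ∃ ε : ℝ, 0 < ε ∧ 4 * (|A| + 1) * ε ≤ 1 ∧ 6 * ε ≤ δ₀ := by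
      have hA : 0 < 4 * (|A| + 1) := by positivity
      refine ⟨min (1 / (4 * (|A| + 1))) (δ₀ / 6), by positivity, ?_, ?_⟩
      · calc _ ≤ 4 * (|A| + 1) * (1 / (4 * (|A| + 1))) := by gcongr; exact min_le_left _ _
          _ = 1 := by field_simp
      · linarith [min_le_right (1 / (4 * (|A| + 1))) (δ₀ / 6)]
    obtain ⟨η, hη, hw⟩ := exists_window_tsum_le (v := S.v) (fun i => (S.ratio_pos i).le)
      S.summable_ratio y hε
    obtain ⟨δ, hδ, hδη, j, hj1, hj2, hj3⟩ := S.spike_right y h0 h1 (1 / ε) η hη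
    -- A tallest spike exists because `H` tends to zero, so only finitely many spikes are at least
    -- as tall as the `j`-th.
    set W : Set ι := {i | y < S.v i ∧ S.v i ≤ y + δ ∧ |S.H j| ≤ |S.H i|} with hW
    have hfin : W.Finite := by
      have : ∀ᶠ i in cofinite, |S.H i| < |S.H j| := by
        have := S.H_tendsto.abs
        rw [abs_zero] at this
        exact this.eventually (eventually_lt_nhds (S.abs_H_pos j))
      refine (this : Set.Finite _).subset ?_
      intro i hi
      simp only [mem_compl_iff, mem_ofPred_eq, not_lt]
      exact hi.2.2
    obtain ⟨i, hi, himax⟩ := Set.exists_max_image W (fun i => |S.H i|) hfin ⟨j, hj1, hj2, le_rfl⟩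
    have hmax : ∀ l, y < S.v l → S.v l ≤ y + δ → |S.H l| ≤ |S.H i| := by
      intro l hl1 hl2
      by_cases hl : |S.H j| ≤ |S.H l|
      · exact himax l ⟨hl1, hl2, hl⟩
      · exact (not_le.1 hl).le.trans hi.2.2
    have hδH : δ ≤ ε * |S.H i| := by
      have : δ ≤ ε * |S.H j| := by
        calc δ = ε * (1 / ε * δ) := by field_simp
          _ ≤ _ := by gcongr
      exact this.trans (mul_le_mul_of_nonneg_left hi.2.2 hε.le)
    have hsum : ∑' l, (S.v ⁻¹' Ioo y (S.v i)).indicator S.g l ≤ |S.H i| * ε := by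
      have hs : S.v ⁻¹' Ioo y (S.v i) ⊆ S.v ⁻¹' Ioc y (y + η) :=
        preimage_mono fun x hx => ⟨hx.1, by linarith [hx.2, hi.2.1]⟩
      calc _ ≤ ∑' l, |S.H i| * (S.v ⁻¹' Ioo y (S.v i)).indicator (fun l => S.g l / |S.H l|) l := by
            refine Summable.tsum_le_tsum (fun l => ?_) (S.summable_g.indicator _)
              ((S.summable_ratio.indicator _).mul_left _)
            by_cases hl : l ∈ S.v ⁻¹' Ioo y (S.v i)
            · rw [indicator_of_mem hl, indicator_of_mem hl]
              conv_lhs => rw [S.g_eq l]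
              exact mul_le_mul_of_nonneg_right (hmax l hl.1 (hl.2.le.trans hi.2.1)) (S.ratio_pos l).le
            · rw [indicator_of_notMem hl, indicator_of_notMem hl, mul_zero]
        _ = |S.H i| * ∑' l, (S.v ⁻¹' Ioo y (S.v i)).indicator (fun l => S.g l / |S.H l|) l :=
            tsum_mul_left
        _ ≤ _ := by gcongr; exact hw _ hs
    have hgi : S.g i ≤ |S.H i| * ε := by
      have h2 := hw {i} (by simpa using ⟨hi.1, by linarith [hi.2.1]⟩)
      have h3 : ∑' l, ({i} : Set ι).indicator (fun l => S.g l / |S.H l|) l = S.g i / |S.H i| := by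
        rw [tsum_eq_single i]
        · simp
        · intro l hl; simp [hl]
      rw [h3] at h2
      rw [S.g_eq i]
      gcongr
    have hgap := h.gap_le y (S.v i) hi.1
    have hgap' := h.le_gap y (S.v i) hi.1
    have hg0 := S.g_pos i
    have hH1 := S.abs_H_le i
    have hH0 := S.abs_H_pos i
    -- The level difference, the gaps in between and the spike's own half-width contribute at most
    -- `ε * |H i|` each.
    have hx : lower (S.v i) + S.g i / 2 - upper y ≤ 3 * ε * |S.H i| := by
      nlinarith [hi.2.1]
    refine ⟨lower (S.v i) + S.g i / 2, by linarith [hi.1], by nlinarith, ?_⟩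
    rw [h.f_middle, fy]
    have h5 : |S.H i| * (1 - ε) ≤ |S.v i + S.H i - y| := by
      have := abs_sub_abs_le_abs_sub (S.H i) (y - S.v i)
      have h6 : |y - S.v i| ≤ ε * |S.H i| := by
        rw [abs_sub_comm, abs_of_pos (by linarith [hi.1])]; linarith [hi.2.1]
      rw [show S.v i + S.H i - y = S.H i - (y - S.v i) by ring]
      linarith
    refine le_trans ?_ h5
    calc A * (lower (S.v i) + S.g i / 2 - upper y)
        ≤ |A| * (lower (S.v i) + S.g i / 2 - upper y) := by
          gcongr
          · linarith [hi.1]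
          · exact le_abs_self A
      _ ≤ |A| * (3 * ε * |S.H i|) := by gcongr
      _ = |S.H i| * (3 * |A| * ε) := by ring
      _ ≤ _ := by
        gcongr
        nlinarith [abs_nonneg A]
  · intro δ hδ
    obtain ⟨z, hz, hz1, hzδ⟩ := key δ hδ
    have h2 := h.le_gap y z hz
    refine ⟨lower z, by linarith, hzδ, ?_⟩
    rw [h.f_lower z ⟨by linarith, hz1⟩, fy]
    linarith
  · intro δ hδ
    obtain ⟨z, hz, hz1, hzδ⟩ := key δ hδ
    have h2 := h.le_gap y z hz
    refine ⟨lower z, by linarith, hzδ, ?_⟩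
    rw [h.f_lower z ⟨by linarith, hz1⟩, fy]
    linarith

end IsSpikeFunction

/-- Quotients are multiplied by `k / w`. For `k < 0` the bounds from above and from below exchange
their roles. -/
lemma _root_.RightOscillating.of_affine {f : ℝ → ℝ} {α w c k s : ℝ} (hw : 0 < w) (hk : k ≠ 0)
    (hf : ∀ s ∈ Icc (0 : ℝ) 1, f (α + w * s) = c + k * f s) (hs0 : 0 ≤ s) (hs1 : s < 1)
    (h : RightOscillating f s) : RightOscillating f (α + w * s) := by
  have key : ∀ (P : ℝ → Prop), (∀ δ, 0 < δ → ∃ x, s < x ∧ x < s + δ ∧ P x) →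
      ∀ δ, 0 < δ → ∃ x, α + w * s < x ∧ x < α + w * s + δ ∧
        ∃ u ∈ Icc (0 : ℝ) 1, x = α + w * u ∧ P u := by
    intro P hP δ hδ
    obtain ⟨u, hu, huδ, hPu⟩ := hP (min (δ / w) (1 - s)) (lt_min (by positivity) (by linarith))
    have h1 := min_le_left (δ / w) (1 - s)
    have h2 := min_le_right (δ / w) (1 - s)
    refine ⟨α + w * u, by gcongr, ?_, u, ⟨by linarith, by linarith⟩, rfl, hPu⟩
    have : w * (u - s) < w * (δ / w) := by gcongr; linarith
    rw [mul_div_cancel₀ _ hw.ne'] at this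
    linarith
  have hfs := hf s ⟨hs0, hs1.le⟩
  have hk' := abs_pos.2 hk
  obtain ⟨h1, ⟨C, h2⟩, ⟨D, h3⟩⟩ := h
  refine ⟨?_, ?_⟩
  · intro A δ hδ
    obtain ⟨x, hx, hx', u, hu, rfl, hP⟩ := key _ (h1 (A * w / |k|)) δ hδ
    refine ⟨_, hx, hx', ?_⟩
    rw [hf u hu, hfs, show c + k * f u - (c + k * f s) = k * (f u - f s) by ring, abs_mul]
    calc _ = |k| * (A * w / |k| * (u - s)) := by field_simp; ring
      _ ≤ _ := by gcongr
  · rcases hk.lt_or_gt with hk0 | hk0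
    · constructor
      · refine ⟨D * k / w, fun δ hδ => ?_⟩
        obtain ⟨x, hx, hx', u, hu, rfl, hP⟩ := key _ h3 δ hδ
        refine ⟨_, hx, hx', ?_⟩
        rw [hf u hu, hfs, show D * k / w * (α + w * u - (α + w * s)) = k * (D * (u - s)) by
          field_simp; ring]
        nlinarith
      · refine ⟨C * k / w, fun δ hδ => ?_⟩
        obtain ⟨x, hx, hx', u, hu, rfl, hP⟩ := key _ h2 δ hδ
        refine ⟨_, hx, hx', ?_⟩
        rw [hf u hu, hfs, show C * k / w * (α + w * u - (α + w * s)) = k * (C * (u - s)) by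
          field_simp; ring]
        nlinarith
    · constructor
      · refine ⟨C * k / w, fun δ hδ => ?_⟩
        obtain ⟨x, hx, hx', u, hu, rfl, hP⟩ := key _ h2 δ hδ
        refine ⟨_, hx, hx', ?_⟩
        rw [hf u hu, hfs, show C * k / w * (α + w * u - (α + w * s)) = k * (C * (u - s)) by
          field_simp; ring]
        nlinarith
      · refine ⟨D * k / w, fun δ hδ => ?_⟩
        obtain ⟨x, hx, hx', u, hu, rfl, hP⟩ := key _ h3 δ hδ
        refine ⟨_, hx, hx', ?_⟩
        rw [hf u hu, hfs, show D * k / w * (α + w * u - (α + w * s)) = k * (D * (u - s)) by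
          field_simp; ring]
        nlinarith

namespace IsSpikeFunction

/-- `t` lies in the half-open left or right half of a spike, at relative position `s`. -/
def InPiece (S : SpikeSystem ι) (lower : ℝ → ℝ) (t s : ℝ) : Prop :=
  ∃ i, t = lower (S.v i) + S.g i / 2 * s ∨ t = lower (S.v i) + S.g i / 2 + S.g i / 2 * s

/-- The estimate `2 * w ≤ |k|` is the gain in steepness from one generation of spikes to the next;
it comes from `g ≤ |H| / 2`. -/
lemma InPiece.affine (h : S.IsSpikeFunction f lower upper) {t s : ℝ} (hp : InPiece S lower t s) :
    ∃ α w c k, 0 < w ∧ w ≤ 1 / 4 ∧ k ≠ 0 ∧ 2 * w ≤ |k| ∧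
      (∀ s ∈ Icc (0 : ℝ) 1, α + w * s ∈ Icc (0 : ℝ) 1) ∧
      (∀ s ∈ Icc (0 : ℝ) 1, f (α + w * s) = c + k * f s) ∧ t = α + w * s := by
  obtain ⟨i, hi⟩ := hp
  have g0 := S.g_pos i
  have h1 := S.g_le_abs_H i
  have h2 := S.abs_H_le i
  have h3 := h.lower_nonneg (S.v_pos i).le
  have h4 := h.upper_v_le_one i
  rcases hi with hi | hi
  · refine ⟨_, _, _, _, half_pos g0, by linarith, S.H_ne i, by linarith, ?_, h.left_piece i, hi⟩
    intro s hs
    have h5 := mul_le_mul_of_nonneg_left hs.2 (half_pos g0).le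
    have h6 := mul_nonneg (half_pos g0).le hs.1
    exact ⟨by linarith, by linarith⟩
  · refine ⟨_, _, S.v i + S.H i, -S.H i, half_pos g0, by linarith, neg_ne_zero.2 (S.H_ne i),
      by rw [abs_neg]; linarith, ?_, ?_, hi⟩
    · intro s hs
      have h5 := mul_le_mul_of_nonneg_left hs.2 (half_pos g0).le
      have h6 := mul_nonneg (half_pos g0).le hs.1
      exact ⟨by linarith, by linarith⟩
    · intro s hs
      rw [h.right_piece i s hs]
      ring

/-- A point of a level set is either some `upper y`, which oscillates, or the left end of a spike.
With the inner points of spikes, what remains is covered by half-open halves, so the relative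
position stays below `1` and is again a bad point by affine transport. -/
lemma exists_inPiece (h : S.IsSpikeFunction f lower upper) {t : ℝ} (h0 : 0 ≤ t) (h1 : t < 1)
    (ht : ¬ RightOscillating f t) :
    ∃ s, 0 ≤ s ∧ s < 1 ∧ ¬ RightOscillating f s ∧ InPiece S lower t s := by
  have key : ∃ s, 0 ≤ s ∧ s < 1 ∧ InPiece S lower t s := by
    rcases h.cover t ⟨h0, h1.le⟩ with ⟨y, hy, hyt⟩ | ⟨i, hi, hi'⟩
    · have hy1 : y < 1 := by
        refine lt_of_le_of_ne hy.2 ?_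
        rintro rfl
        have : upper 1 = lower 1 := h.upper_eq_lower 1 (by
          rintro ⟨i, hi⟩
          exact (S.v_lt_one i).ne hi)
        rcases hyt with rfl | rfl
        · rw [← this, h.upper_one] at h1; exact lt_irrefl _ h1
        · rw [h.upper_one] at h1; exact lt_irrefl _ h1
      have hup : t ≠ upper y := by
        rintro rfl
        exact ht (h.rightOscillating_upper hy.1 hy1)
      have hlow : t = lower y := hyt.resolve_right hup
      by_cases hr : y ∈ range S.v
      · obtain ⟨i, rfl⟩ := hr
        exact ⟨0, le_rfl, one_pos, i, Or.inl (by simpa using hlow)⟩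
      · exact absurd (hlow.trans (h.upper_eq_lower y hr).symm) hup
    · have g0 := S.g_pos i
      by_cases hm : t < lower (S.v i) + S.g i / 2
      · refine ⟨(t - lower (S.v i)) / (S.g i / 2), div_nonneg (by linarith) (by linarith), ?_, i,
          Or.inl ?_⟩
        · rw [div_lt_one (by linarith)]; linarith
        · field_simp; ring
      · refine ⟨(t - lower (S.v i) - S.g i / 2) / (S.g i / 2),
          div_nonneg (by linarith) (by linarith), ?_, i, Or.inr ?_⟩
        · rw [div_lt_one (by linarith)]; linarith
        · field_simp; ring
  obtain ⟨s, hs0, hs1, hp⟩ := key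
  refine ⟨s, hs0, hs1, fun hs => ?_, hp⟩
  obtain ⟨α, w, c, k, hw, -, hk, -, -, hf, rfl⟩ := hp.affine h
  exact ht (hs.of_affine hw hk hf hs0 hs1)

/-- If `t` lies in the spikes of the first two generations, `f` cannot stay above `f t` all the way
to the right of `t`. -/
lemma not_forall_lt (h : S.IsSpikeFunction f lower upper) {t s r : ℝ} (hs0 : 0 ≤ s) (hs1 : s < 1)
    (hr0 : 0 ≤ r) (hr1 : r < 1)
    (hts : InPiece S lower t s) (hsr : InPiece S lower s r)
    (ht : ∀ x, t < x → x ≤ 1 → f t < f x) (hs : ∀ x, s < x → x ≤ 1 → f s < f x) : False := by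
  -- The middle and the right end of the spike take the values `v + H` and `v`. A point of the left
  -- half has a value between these, so it cannot lie below both; in the right half, lying below `v`
  -- forces `H < 0`.
  have key : ∀ t s, 0 ≤ s → s < 1 → InPiece S lower t s → (∀ x, t < x → x ≤ 1 → f t < f x) →
      ∃ i, S.H i < 0 ∧ t = lower (S.v i) + S.g i / 2 + S.g i / 2 * s := by
    intro t s hs0 hs1 ⟨i, hi⟩ ht
    have g0 := S.g_pos i
    have h4 := h.upper_v_le_one i
    have h5 := mul_lt_mul_of_pos_left hs1 (half_pos g0)
    have h6 := h.f_mem s ⟨hs0, hs1.le⟩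
    have hb := ht (lower (S.v i) + S.g i) (by rcases hi with rfl | rfl <;> linarith) h4
    rw [h.f_right_end] at hb
    rcases hi with hi | hi
    · have hm := ht (lower (S.v i) + S.g i / 2) (by linarith) (by linarith)
      rw [h.f_middle] at hm
      rw [hi, h.left_piece i s ⟨hs0, hs1.le⟩] at hb hm
      exfalso
      rcases (S.H_ne i).lt_or_gt with hH | hH <;> nlinarith [h6.1, h6.2]
    · refine ⟨i, ?_, hi⟩
      rw [hi, h.right_piece i s ⟨hs0, hs1.le⟩] at hb
      by_contra hH
      nlinarith [h6.1, h6.2]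
  obtain ⟨i, hi, hti⟩ := key t s hs0 hs1 hts ht
  obtain ⟨l, hl, hsl⟩ := key s r hr0 hr1 hsr hs
  have hfs : 1 / 4 ≤ f s := by
    rw [hsl, h.right_piece l r ⟨hr0, hr1.le⟩]
    have := S.low_of_neg l hl
    have := (h.f_mem r ⟨hr0, hr1.le⟩).1
    nlinarith
  -- Since `f s ≥ 1/4`, the value at `t` uses at most three quarters of the depth of its spike. The
  -- tip of the `j`-th spike, further right, reaches at least as low.
  obtain ⟨j, hj, hj'⟩ := S.cover_right i hi
  have g0 := S.g_pos j
  have h1 := h.le_gap _ _ hj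
  rw [h.upper_v] at h1
  have h5 := mul_lt_mul_of_pos_left hs1 (half_pos (S.g_pos i))
  have h2 := ht (lower (S.v j) + S.g j / 2) (by linarith) (by linarith [h.upper_v_le_one j])
  rw [h.f_middle, hti, h.right_piece i s ⟨hs0, hs1.le⟩] at h2
  nlinarith

/-- Iterating `exists_inPiece` from a bad point gives relative positions `T n` in nested pieces, and
self-similarity lets the global shape of `f` be seen at arbitrarily small scales to the right of
`t`. -/
theorem rightOscillating (h : S.IsSpikeFunction f lower upper) {t : ℝ} (h0 : 0 ≤ t) (h1 : t < 1) :
    RightOscillating f t := by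
  by_contra ht
  choose! F hF0 hF1 hF2 hFp using fun (t : ℝ) (h : (0 ≤ t ∧ t < 1 ∧ ¬ RightOscillating f t)) =>
    exists_inPiece ‹S.IsSpikeFunction f lower upper› h.1 h.2.1 h.2.2
  set T : ℕ → ℝ := fun n => F^[n] t with hT
  have hTs : ∀ n, T (n + 1) = F (T n) := fun n => Function.iterate_succ_apply' F n t
  have hbad : ∀ n, 0 ≤ T n ∧ T n < 1 ∧ ¬ RightOscillating f (T n) := by
    intro n
    induction n with
    | zero => exact ⟨h0, h1, ht⟩
    | succ n ih =>
      rw [hTs]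
      exact ⟨hF0 _ ih, hF1 _ ih, hF2 _ ih⟩
  have hp : ∀ n, InPiece S lower (T n) (T (n + 1)) := fun n => by
    rw [hTs]; exact hFp _ (hbad n)
  have hchain : ∀ n : ℕ, ∃ α w c k, 0 < w ∧ w ≤ (1 / 4 : ℝ) ^ n ∧ k ≠ 0 ∧ 2 ^ n * w ≤ |k| ∧
      (∀ s ∈ Icc (0 : ℝ) 1, α + w * s ∈ Icc (0 : ℝ) 1) ∧
      (∀ s ∈ Icc (0 : ℝ) 1, f (α + w * s) = c + k * f s) ∧ t = α + w * T n := by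
    intro n
    induction n with
    | zero => exact ⟨0, 1, 0, 1, by simp [hT]⟩
    | succ n ih =>
      obtain ⟨α, w, c, k, hw, hwn, hk, hkw, hm, hf, hα⟩ := ih
      obtain ⟨α', w', c', k', hw', hwn', hk', hkw', hm', hf', hα'⟩ := (hp n).affine h
      refine ⟨α + w * α', w * w', c + k * c', k * k', by positivity, ?_, mul_ne_zero hk hk', ?_,
        ?_, ?_, ?_⟩
      · rw [pow_succ]; gcongr
      · rw [abs_mul, pow_succ]
        calc _ = (2 ^ n * w) * (2 * w') := by ring
          _ ≤ _ := by gcongr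
      · intro s hs
        have := hm _ (hm' s hs)
        convert this using 1
        ring
      · intro s hs
        have := hf _ (hm' s hs)
        rw [hf' s hs] at this
        rw [show α + w * α' + w * w' * s = α + w * (α' + w' * s) by ring, this]
        ring
      · rw [hα, hα']; ring
  obtain ⟨b, hb, hbound⟩ := h.bound
  have hpow : ∀ δ, 0 < δ → ∀ᶠ n : ℕ in atTop, (1 / 4 : ℝ) ^ n < δ := fun δ hδ =>
    (tendsto_pow_atTop_nhds_zero_of_lt_one (by norm_num) (by norm_num)).eventually
      (eventually_lt_nhds hδ)
  have hsign : ∀ σ : ℝ, ¬ ∃ δ > 0, ∀ x, t < x → x < t + δ → 0 < σ * (f x - f t) := by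
    rintro σ ⟨δ, hδ, hx⟩
    obtain ⟨N, hN⟩ := eventually_atTop.1 (hpow δ hδ)
    -- Once the `n`-th piece fits into the window, the one-sided sign becomes global for `f`
    -- relative to `T n`. Testing at `1`, where `f` is maximal, shows `σ * k > 0` and fixes its
    -- direction.
    have hglob : ∀ n, N ≤ n → ∀ x, T n < x → x ≤ 1 → f (T n) < f x := by
      intro n hn
      obtain ⟨α, w, c, k, hw, hwn, hk, hkw, hm, hf, hα⟩ := hchain n
      have hTn := hbad n
      have hloc : ∀ x, T n < x → x ≤ 1 → 0 < σ * k * (f x - f (T n)) := by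
        intro x hx1 hx2
        have h3 : w * (x - T n) ≤ w * 1 := by gcongr; linarith
        have h2 := hx (α + w * x) (by rw [hα]; gcongr) (by linarith [hN n hn])
        rw [hf x ⟨by linarith, hx2⟩, hα, hf (T n) ⟨hTn.1, hTn.2.1.le⟩] at h2
        convert h2 using 1
        ring
      have h3 := hloc 1 hTn.2.1 le_rfl
      rw [h.f_one] at h3
      have h4 : 0 < σ * k := by
        by_contra h5
        nlinarith [(h.f_mem (T n) ⟨hTn.1, hTn.2.1.le⟩).2]
      intro x hx1 hx2
      have := (mul_pos_iff_of_pos_left h4).1 (hloc x hx1 hx2)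
      linarith
    exact h.not_forall_lt (hbad _).1 (hbad _).2.1 (hbad _).1 (hbad _).2.1 (hp N) (hp (N + 1))
      (hglob N le_rfl) (hglob (N + 1) (by omega))
  refine ht ⟨?_, ⟨0, ?_⟩, ⟨0, ?_⟩⟩
  · intro A δ hδ
    -- Compare with the right end of the `n`-th piece: `1 - f (T n) ≥ b * (1 - T n)`, and the piece
    -- has `|k| / w ≥ 2 ^ n`.
    have hA : ∀ᶠ n : ℕ in atTop, A / b ≤ 2 ^ n :=
      (tendsto_pow_atTop_atTop_of_one_lt (by norm_num : (1 : ℝ) < 2)).eventually_ge_atTop _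
    obtain ⟨n, hn, hn'⟩ := ((hpow δ hδ).and hA).exists
    obtain ⟨α, w, c, k, hw, hwn, hk, hkw, hm, hf, hα⟩ := hchain n
    have hTn := hbad n
    have h2 := (hbound (T n) ⟨hTn.1, hTn.2.1.le⟩).2
    have h3 : w * T n < w * 1 := by gcongr; exact hTn.2.1
    refine ⟨α + w * 1, by linarith, by nlinarith, ?_⟩
    rw [hf 1 (by simp), hα, hf (T n) ⟨hTn.1, hTn.2.1.le⟩, h.f_one,
      show c + k * 1 - (c + k * f (T n)) = k * (1 - f (T n)) by ring, abs_mul]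
    have h4 : 0 < 1 - T n := by linarith
    rw [div_le_iff₀ hb] at hn'
    calc A * (α + w * 1 - (α + w * T n)) = A * (w * (1 - T n)) := by ring
      _ ≤ (2 ^ n * b) * (w * (1 - T n)) := by gcongr
      _ = (2 ^ n * w) * (b * (1 - T n)) := by ring
      _ ≤ |k| * |1 - f (T n)| := by
        gcongr
        exact h2.trans (le_abs_self _)
  · by_contra! hc
    obtain ⟨δ, hδ, hx⟩ := hc
    refine hsign 1 ⟨δ, hδ, fun x hx1 hx2 => ?_⟩
    linarith [hx x hx1 hx2]
  · by_contra! hc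
    obtain ⟨δ, hδ, hx⟩ := hc
    refine hsign (-1) ⟨δ, hδ, fun x hx1 hx2 => ?_⟩
    linarith [hx x hx1 hx2]

theorem rightOscillating_flip (h : S.IsSpikeFunction f lower upper) {t : ℝ} (h0 : 0 < t)
    (h1 : t ≤ 1) : RightOscillating (fun x => 1 - f (1 - x)) (1 - t) :=
  h.flip.rightOscillating (by linarith) (by linarith)

end IsSpikeFunction
end SpikeSystem

/-! ### The increasing part and its multivalued inverse -/

namespace SpikeSystem
variable {ι : Type*} (S : SpikeSystem ι)

/-- The proportion of the height interval of the `i`-th spike that lies below `y`. -/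
noncomputable def fill (i : ι) (y : ℝ) : ℝ :=
  max 0 (min 1 ((y - min (S.v i) (S.v i + S.H i)) / |S.H i|))

lemma fill_nonneg (i : ι) (y : ℝ) : 0 ≤ S.fill i y := le_max_left _ _

lemma fill_le_one (i : ι) (y : ℝ) : S.fill i y ≤ 1 :=
  max_le zero_le_one (min_le_left _ _)

lemma fill_mono (i : ι) {y z : ℝ} (h : y ≤ z) : S.fill i y ≤ S.fill i z := by
  unfold fill
  gcongr

lemma fill_sub_le (i : ι) {y z : ℝ} (h : y ≤ z) :
    S.fill i z - S.fill i y ≤ (z - y) / |S.H i| := by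
  have h1 : (z - min (S.v i) (S.v i + S.H i)) / |S.H i| =
    (y - min (S.v i) (S.v i + S.H i)) / |S.H i| + (z - y) / |S.H i| := by ring
  have h2 : 0 ≤ (z - y) / |S.H i| := div_nonneg (by linarith) (abs_nonneg _)
  unfold fill
  rw [h1]
  generalize (y - min (S.v i) (S.v i + S.H i)) / |S.H i| = a at *
  generalize (z - y) / |S.H i| = b at *
  rcases max_cases 0 (min 1 a) with h3 | h3 <;> rcases max_cases 0 (min 1 (a + b)) with h4 | h4 <;>
    rcases min_cases 1 a with h5 | h5 <;> rcases min_cases 1 (a + b) with h6 | h6 <;> linarith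

lemma fill_zero (i : ι) : S.fill i 0 = 0 := by
  apply max_eq_left
  apply (min_le_right _ _).trans
  apply div_nonpos_of_nonpos_of_nonneg _ (abs_nonneg _)
  have := S.range_low i
  have := S.v_pos i
  have : 0 ≤ min (S.v i) (S.v i + S.H i) := le_min (by linarith) (by linarith)
  linarith

lemma fill_one (i : ι) : S.fill i 1 = 1 := by
  unfold fill
  rw [min_eq_left, max_eq_right zero_le_one]
  rw [le_div_iff₀ (S.abs_H_pos i), one_mul]
  have := S.range_high i
  have := S.v_lt_one i
  rcases min_cases (S.v i) (S.v i + S.H i) with h | h <;>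
    rcases abs_cases (S.H i) with h' | h' <;> linarith

/-- The left end of the level set of `y` of the increasing part of the spike function. -/
noncomputable def lower (y : ℝ) : ℝ :=
  y + ∑' i, S.g i * ((if S.v i < y then 1 else 0) - S.fill i y)

/-- The right end of the level set of `y` of the increasing part of the spike function. -/
noncomputable def upper (y : ℝ) : ℝ :=
  y + ∑' i, S.g i * ((if S.v i ≤ y then 1 else 0) - S.fill i y)

lemma summable_of_abs_le_one {u : ι → ℝ} (hu : ∀ i, |u i| ≤ 1) :
    Summable fun i => S.g i * u i := by
  refine Summable.of_norm_bounded S.summable_g fun i => ?_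
  rw [Real.norm_eq_abs, abs_mul, abs_of_pos (S.g_pos i)]
  exact mul_le_of_le_one_right (S.g_pos i).le (hu i)

lemma abs_ite_sub_fill_le (i : ι) (p : Prop) [Decidable p] (y : ℝ) :
    |(if p then 1 else 0) - S.fill i y| ≤ 1 := by
  have h1 := S.fill_nonneg i y
  have h2 := S.fill_le_one i y
  rw [abs_le]
  split_ifs <;> constructor <;> linarith

lemma summable_lower (y : ℝ) :
    Summable fun i => S.g i * ((if S.v i < y then 1 else 0) - S.fill i y) :=
  S.summable_of_abs_le_one fun i => S.abs_ite_sub_fill_le i _ y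

lemma summable_upper (y : ℝ) :
    Summable fun i => S.g i * ((if S.v i ≤ y then 1 else 0) - S.fill i y) :=
  S.summable_of_abs_le_one fun i => S.abs_ite_sub_fill_le i _ y

/-- The jumps only help, and `fill i` has Lipschitz constant `1 / |H i|`, so the subtracted terms
cost at most `∑ g i / |H i| ≤ 1/2` of `z - y`. This makes the increasing part Lipschitz with
constant `2`. -/
lemma le_gap {y z : ℝ} (h : y < z) : (z - y) / 2 ≤ S.lower z - S.upper y := by
  have h1 : ∑' i, S.g i * ((if S.v i ≤ y then 1 else 0) - S.fill i y) ≤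
      ∑' i, (S.g i * ((if S.v i < z then 1 else 0) - S.fill i z) + S.g i / |S.H i| * (z - y)) := by
    refine Summable.tsum_le_tsum (fun i => ?_) (S.summable_upper y)
      ((S.summable_lower z).add (S.summable_ratio.mul_right _))
    have h2 : S.g i * (S.fill i z - S.fill i y) ≤ S.g i * ((z - y) / |S.H i|) :=
      mul_le_mul_of_nonneg_left (S.fill_sub_le i h.le) (S.g_pos i).le
    have h3 : (if S.v i ≤ y then (1 : ℝ) else 0) ≤ if S.v i < z then 1 else 0 := by
      split_ifs <;> linarith
    have h4 := mul_le_mul_of_nonneg_left h3 (S.g_pos i).le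
    have h5 : S.g i / |S.H i| * (z - y) = S.g i * ((z - y) / |S.H i|) := by ring
    linarith
  rw [Summable.tsum_add (S.summable_lower z) (S.summable_ratio.mul_right _), tsum_mul_right] at h1
  have h2 := mul_le_mul_of_nonneg_right S.tsum_ratio_le (sub_nonneg.2 h.le)
  unfold lower upper
  linarith

/-- By monotonicity of `fill`, only the jumps strictly between `y` and `z` can lengthen the gap
beyond `z - y`. -/
lemma gap_le {y z : ℝ} (h : y < z) :
    S.lower z - S.upper y ≤ z - y + ∑' i, (S.v ⁻¹' Ioo y z).indicator S.g i := by
  have h1 : ∑' i, S.g i * ((if S.v i < z then 1 else 0) - S.fill i z) ≤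
      ∑' i, (S.g i * ((if S.v i ≤ y then 1 else 0) - S.fill i y) +
        (S.v ⁻¹' Ioo y z).indicator S.g i) := by
    refine Summable.tsum_le_tsum (fun i => ?_) (S.summable_lower z)
      ((S.summable_upper y).add (S.summable_g.indicator _))
    have h4 := mul_le_mul_of_nonneg_left (S.fill_mono i h.le) (S.g_pos i).le
    rcases le_or_gt (S.v i) y with h5 | h5
    · rw [if_pos h5, if_pos (h5.trans_lt h),
        indicator_of_notMem (fun h => absurd h5 (not_le.2 h.1))]
      linarith
    · rw [if_neg (not_le.2 h5)]
      by_cases h6 : S.v i < z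
      · rw [if_pos h6, indicator_of_mem (show i ∈ S.v ⁻¹' Ioo y z from ⟨h5, h6⟩)]; linarith
      · rw [if_neg h6, indicator_of_notMem (fun h => h6 h.2)]; linarith
  rw [Summable.tsum_add (S.summable_upper y) (S.summable_g.indicator _)] at h1
  unfold lower upper
  linarith

lemma upper_sub_lower (y : ℝ) :
    S.upper y - S.lower y = ∑' i, S.g i * (if S.v i = y then 1 else 0) := by
  unfold upper lower
  rw [add_sub_add_left_eq_sub, ← Summable.tsum_sub (S.summable_upper y) (S.summable_lower y)]
  congr 1
  ext i
  rcases lt_trichotomy (S.v i) y with h | h | h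
  · simp [h, h.le, h.ne]
  · simp [h]; ring
  · simp [h.not_gt, h.not_ge, h.ne']

lemma upper_v (i : ι) : S.upper (S.v i) = S.lower (S.v i) + S.g i := by
  have := S.upper_sub_lower (S.v i)
  rw [tsum_eq_single i fun j hj => by rw [if_neg (S.v_injective.ne hj), mul_zero]] at this
  simp at this
  linarith

lemma upper_eq_lower {y : ℝ} (hy : y ∉ range S.v) : S.upper y = S.lower y := by
  have := S.upper_sub_lower y
  rw [tsum_congr fun i => by rw [if_neg fun h => hy ⟨i, h⟩, mul_zero], tsum_zero] at this
  linarith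

lemma lower_le_upper (y : ℝ) : S.lower y ≤ S.upper y := by
  rw [← sub_nonneg, S.upper_sub_lower y]
  exact tsum_nonneg fun i => mul_nonneg (S.g_pos i).le (by split_ifs <;> norm_num)

lemma lower_zero : S.lower 0 = 0 := by
  simp only [lower, S.fill_zero, (S.v_pos _).not_gt]
  simp

lemma upper_zero : S.upper 0 = 0 := by
  rw [S.upper_eq_lower, S.lower_zero]
  rintro ⟨i, hi⟩
  exact (S.v_pos i).ne' hi

lemma upper_one : S.upper 1 = 1 := by
  simp only [upper, S.fill_one, (S.v_lt_one _).le]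
  simp

lemma lower_one : S.lower 1 = 1 := by
  rw [← S.upper_eq_lower, S.upper_one]
  rintro ⟨i, hi⟩
  exact (S.v_lt_one i).ne hi

lemma upper_lt_lower {y z : ℝ} (h : y < z) : S.upper y < S.lower z := by
  linarith [S.le_gap h]

lemma upper_mono {y z : ℝ} (h : y ≤ z) : S.upper y ≤ S.upper z := by
  rcases h.eq_or_lt with rfl | h
  · rfl
  · exact (S.upper_lt_lower h).le.trans (S.lower_le_upper z)

lemma lower_nonneg {y : ℝ} (h : 0 ≤ y) : 0 ≤ S.lower y := by
  rcases h.eq_or_lt with rfl | h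
  · exact S.lower_zero.ge
  · exact S.upper_zero.symm.le.trans (S.upper_lt_lower h).le

lemma upper_le_one {y : ℝ} (h : y ≤ 1) : S.upper y ≤ 1 := by
  rw [← S.upper_one]
  exact S.upper_mono h

lemma exists_lower_lt (y : ℝ) {c : ℝ} (h : S.upper y < c) : ∃ δ > 0, S.lower (y + δ) < c := by
  obtain ⟨δ, hδ, hw⟩ := exists_window_tsum_le (v := S.v) (fun i => (S.g_pos i).le) S.summable_g y
    (half_pos (sub_pos.2 h))
  have h0 : 0 < min δ ((c - S.upper y) / 4) := lt_min hδ (by linarith)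
  refine ⟨_, h0, ?_⟩
  have h1 := S.gap_le (lt_add_of_pos_right y h0)
  have h2 := hw (S.v ⁻¹' Ioo y (y + min δ ((c - S.upper y) / 4)))
    (preimage_mono fun x hx => ⟨hx.1, by linarith [hx.2, min_le_left δ ((c - S.upper y) / 4)]⟩)
  linarith [min_le_right δ ((c - S.upper y) / 4)]

lemma fill_flip (i : ι) (y : ℝ) : S.flip.fill i (1 - y) = 1 - S.fill i y := by
  have hH := S.abs_H_pos i
  have h1 : (1 - y - min (1 - S.v i) (1 - S.v i + -S.H i)) / |S.H i| =
      1 - (y - min (S.v i) (S.v i + S.H i)) / |S.H i| := by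
    rw [eq_sub_iff_add_eq, ← add_div, div_eq_one_iff_eq hH.ne']
    rcases min_cases (S.v i) (S.v i + S.H i) with h | h <;>
      rcases min_cases (1 - S.v i) (1 - S.v i + -S.H i) with h' | h' <;>
      rcases abs_cases (S.H i) with h'' | h'' <;> linarith
  simp only [fill, SpikeSystem.flip, abs_neg]
  rw [h1]
  generalize (y - min (S.v i) (S.v i + S.H i)) / |S.H i| = a at *
  rcases max_cases 0 (min 1 a) with h3 | h3 <;> rcases max_cases 0 (min 1 (1 - a)) with h4 | h4 <;>
    rcases min_cases 1 a with h5 | h5 <;> rcases min_cases 1 (1 - a) with h6 | h6 <;> linarith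

lemma upper_flip (y : ℝ) : S.flip.upper (1 - y) = 1 - S.lower y := by
  unfold upper lower
  rw [sub_add_eq_sub_sub, sub_eq_add_neg (1 - y), ← tsum_neg]
  congr 2
  ext i
  have hv : S.flip.v i = 1 - S.v i := rfl
  have hg : S.flip.g i = S.g i := rfl
  rw [S.fill_flip, hg]
  rcases lt_or_ge (S.v i) y with h | h
  · rw [if_pos h, if_neg (by rw [hv]; linarith)]; ring
  · rw [if_neg h.not_gt, if_pos (by rw [hv]; linarith)]; ring

lemma lower_flip (y : ℝ) : S.flip.lower (1 - y) = 1 - S.upper y := by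
  unfold upper lower
  rw [sub_add_eq_sub_sub, sub_eq_add_neg (1 - y), ← tsum_neg]
  congr 2
  ext i
  have hv : S.flip.v i = 1 - S.v i := rfl
  have hg : S.flip.g i = S.g i := rfl
  rw [S.fill_flip, hg]
  rcases le_or_gt (S.v i) y with h | h
  · rw [if_pos h, if_neg (by rw [hv]; linarith)]; ring
  · rw [if_neg h.not_ge, if_pos (by rw [hv]; linarith)]; ring

lemma exists_lt_upper (y : ℝ) {c : ℝ} (h : c < S.lower y) : ∃ δ > 0, c < S.upper (y - δ) := by
  obtain ⟨δ, hδ, h1⟩ := S.flip.exists_lower_lt (1 - y) (c := 1 - c) (by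
    rw [S.upper_flip]; linarith)
  refine ⟨δ, hδ, ?_⟩
  rw [show 1 - y + δ = 1 - (y - δ) by ring, S.lower_flip] at h1
  linarith

/-- The level is the supremum of all `y` with `lower y ≤ x`; one-sided continuity of `upper` and
`lower` gives the two inequalities there. -/
lemma exists_lower_le_upper {x : ℝ} (hx : x ∈ Icc (0 : ℝ) 1) :
    ∃ y ∈ Icc (0 : ℝ) 1, S.lower y ≤ x ∧ x ≤ S.upper y := by
  set A := {y | y ∈ Icc (0 : ℝ) 1 ∧ S.lower y ≤ x} with hA
  have h0 : (0 : ℝ) ∈ A := ⟨by simp, S.lower_zero.trans_le hx.1⟩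
  have hb : BddAbove A := ⟨1, fun y hy => hy.1.2⟩
  have hs0 : 0 ≤ sSup A := le_csSup hb h0
  have hs1 : sSup A ≤ 1 := csSup_le ⟨0, h0⟩ fun y hy => hy.1.2
  refine ⟨sSup A, ⟨hs0, hs1⟩, ?_, ?_⟩
  · by_contra! h
    obtain ⟨δ, hδ, h1⟩ := S.exists_lt_upper _ h
    obtain ⟨y, hy, h2⟩ := exists_lt_of_lt_csSup ⟨0, h0⟩ (sub_lt_self (sSup A) hδ)
    linarith [S.upper_lt_lower h2, hy.2]
  · by_contra! h
    have hlt : sSup A < 1 := by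
      refine lt_of_le_of_ne hs1 fun h1 => ?_
      rw [h1, S.upper_one] at h
      exact absurd hx.2 h.not_ge
    obtain ⟨δ, hδ, h1⟩ := S.exists_lower_lt _ h
    have h2 : 0 < min δ (1 - sSup A) := lt_min hδ (by linarith)
    have h3 : S.lower (sSup A + min δ (1 - sSup A)) ≤ S.lower (sSup A + δ) := by
      rcases (min_le_left δ (1 - sSup A)).eq_or_lt with h | h
      · rw [h]
      · exact (S.lower_le_upper _).trans (S.upper_lt_lower (by linarith)).le
    have h4 : sSup A + min δ (1 - sSup A) ∈ A :=
      ⟨⟨by linarith, by linarith [min_le_right δ (1 - sSup A)]⟩, by linarith⟩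
    linarith [le_csSup hb h4]

lemma le_of_lower_le_upper {y z : ℝ} (h : S.lower y ≤ S.upper z) : y ≤ z := by
  by_contra! h1
  linarith [S.upper_lt_lower h1]

/-- The increasing part of the spike function, constant on the intervals carrying the spikes. -/
noncomputable def base (x : ℝ) : ℝ :=
  (S.exists_lower_le_upper (projIcc (0 : ℝ) 1 zero_le_one x).2).choose

lemma base_mem (x : ℝ) : S.base x ∈ Icc (0 : ℝ) 1 :=
  (S.exists_lower_le_upper (projIcc (0 : ℝ) 1 zero_le_one x).2).choose_spec.1

lemma lower_base_le (x : ℝ) : S.lower (S.base x) ≤ projIcc (0 : ℝ) 1 zero_le_one x :=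
  (S.exists_lower_le_upper (projIcc (0 : ℝ) 1 zero_le_one x).2).choose_spec.2.1

lemma le_upper_base (x : ℝ) : projIcc (0 : ℝ) 1 zero_le_one x ≤ S.upper (S.base x) :=
  (S.exists_lower_le_upper (projIcc (0 : ℝ) 1 zero_le_one x).2).choose_spec.2.2

lemma base_eq {x y : ℝ} (hx : x ∈ Icc (0 : ℝ) 1) (h1 : S.lower y ≤ x) (h2 : x ≤ S.upper y) :
    S.base x = y := by
  have h3 := S.lower_base_le x
  have h4 := S.le_upper_base x
  rw [projIcc_of_mem _ hx] at h3 h4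
  exact le_antisymm (S.le_of_lower_le_upper (h3.trans h2)) (S.le_of_lower_le_upper (h1.trans h4))

lemma base_of_nonpos {x : ℝ} (hx : x ≤ 0) : S.base x = 0 := by
  have h3 := S.lower_base_le x
  rw [projIcc_of_le_left _ hx] at h3
  exact le_antisymm (S.le_of_lower_le_upper (h3.trans S.upper_zero.ge)) (S.base_mem x).1

lemma base_of_one_le {x : ℝ} (hx : 1 ≤ x) : S.base x = 1 := by
  have h3 := S.le_upper_base x
  rw [projIcc_of_right_le _ hx] at h3
  exact le_antisymm (S.base_mem x).2 (S.le_of_lower_le_upper (S.lower_one.le.trans h3))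

lemma base_sub_le {x x' : ℝ} (h : x ≤ x') : |S.base x' - S.base x| ≤ 2 * (x' - x) := by
  have h0 : (projIcc (0 : ℝ) 1 zero_le_one x' : ℝ) - projIcc (0 : ℝ) 1 zero_le_one x ≤ x' - x := by
    have := abs_projIcc_sub_projIcc (a := (0 : ℝ)) (b := 1) (c := x') (d := x) zero_le_one
    rw [abs_of_nonneg (by linarith : 0 ≤ x' - x)] at this
    exact (le_abs_self _).trans this
  have h1 : (projIcc (0 : ℝ) 1 zero_le_one x : ℝ) ≤ projIcc (0 : ℝ) 1 zero_le_one x' :=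
    monotone_projIcc _ h
  have h2 := S.le_upper_base x
  have h3 := S.lower_base_le x'
  have h4 := S.le_upper_base x'
  have h5 := S.lower_base_le x
  have h6 : S.base x ≤ S.base x' := S.le_of_lower_le_upper (h5.trans (h1.trans h4))
  rw [abs_of_nonneg (by linarith)]
  rcases h6.eq_or_lt with h6 | h6
  · rw [h6]; linarith
  · linarith [S.le_gap h6]

lemma continuous_base : Continuous S.base := by
  refine (LipschitzWith.of_dist_le_mul (K := 2) fun x y => ?_).continuous
  rw [Real.dist_eq, Real.dist_eq, NNReal.coe_ofNat]
  rcases le_total x y with h | h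
  · rw [abs_sub_comm, abs_sub_comm x, abs_of_nonneg (by linarith : 0 ≤ y - x)]
    exact S.base_sub_le h
  · rw [abs_of_nonneg (by linarith : 0 ≤ x - y)]
    exact S.base_sub_le h

lemma base_upper {y : ℝ} (hy : y ∈ Icc (0 : ℝ) 1) : S.base (S.upper y) = y :=
  S.base_eq ⟨(S.lower_nonneg hy.1).trans (S.lower_le_upper y), S.upper_le_one hy.2⟩
    (S.lower_le_upper y) le_rfl

lemma base_lower {y : ℝ} (hy : y ∈ Icc (0 : ℝ) 1) : S.base (S.lower y) = y :=
  S.base_eq ⟨S.lower_nonneg hy.1, (S.lower_le_upper y).trans (S.upper_le_one hy.2)⟩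
    le_rfl (S.lower_le_upper y)

/-- The interval that carries the `i`-th spike. -/
def gap (i : ι) : Set ℝ := Ioo (S.lower (S.v i)) (S.lower (S.v i) + S.g i)

lemma lower_add_g_lt {i j : ι} (h : S.v i < S.v j) :
    S.lower (S.v i) + S.g i < S.lower (S.v j) := by
  rw [← S.upper_v]
  exact S.upper_lt_lower h

lemma notMem_gap_of_mem_Icc {i j : ι} (hij : i ≠ j) {x : ℝ}
    (hx : x ∈ Icc (S.lower (S.v i)) (S.lower (S.v i) + S.g i)) : x ∉ S.gap j := by
  intro hj
  rcases (S.v_injective.ne hij).lt_or_gt with h | h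
  · linarith [S.lower_add_g_lt h, hx.2, hj.1]
  · linarith [S.lower_add_g_lt h, hx.1, hj.2]

lemma gap_subset (i : ι) : S.gap i ⊆ Icc 0 1 := by
  intro x hx
  have h1 := S.lower_nonneg (S.v_pos i).le
  have h2 := S.upper_le_one (S.v_lt_one i).le
  rw [S.upper_v] at h2
  exact ⟨by linarith [hx.1], by linarith [hx.2]⟩

/-! ### The spike operator and its fixed point -/

/-- The coordinate on the `i`-th gap, running from `0` to `2`. -/
noncomputable def phase (i : ι) (x : ℝ) : ℝ := 2 * (x - S.lower (S.v i)) / S.g i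

lemma notMem_gap_iff {i : ι} {x : ℝ} : x ∉ S.gap i ↔ S.phase i x ≤ 0 ∨ 2 ≤ S.phase i x := by
  have := S.g_pos i
  rw [gap, mem_Ioo, phase, div_le_iff₀ this, le_div_iff₀ this, not_and_or, not_lt, not_lt]
  constructor <;> rintro (h | h) <;> [left; right; left; right] <;> linarith

/-- One step of the construction of the spike function: the spikes of height `H` are filled with two
copies of `f`. -/
noncomputable def spikeMap (f : ℝ → ℝ) (x : ℝ) : ℝ :=
  S.base x + ∑' i, S.H i * (f (S.phase i x) - f (S.phase i x - 1))

/-- The functions from `ℝ` to `[0, 1]` that are `0` left of `0` and `1` right of `1`. -/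
structure IsClamped (f : ℝ → ℝ) : Prop where
  mem : ∀ x, f x ∈ Icc (0 : ℝ) 1
  left : ∀ x ≤ 0, f x = 0
  right : ∀ x ≥ 1, f x = 1

variable {S} {f : ℝ → ℝ}

/-- Clamping makes the second term vanish for phases up to `1` and the first equal to `1`
afterwards: the difference climbs along `f`, then descends along `1 - f`. -/
lemma IsClamped.sub_mem (hf : IsClamped f) (p : ℝ) : f p - f (p - 1) ∈ Icc (0 : ℝ) 1 := by
  have h1 := hf.mem p
  have h2 := hf.mem (p - 1)
  rcases le_total p 1 with h | h
  · rw [hf.left (p - 1) (by linarith), sub_zero]; exact h1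
  · rw [hf.right p h]; exact ⟨by linarith [h2.2], by linarith [h2.1]⟩

lemma IsClamped.spike_eq_zero (hf : IsClamped f) {i : ι} {x : ℝ} (hx : x ∉ S.gap i) :
    f (S.phase i x) - f (S.phase i x - 1) = 0 := by
  rcases S.notMem_gap_iff.1 hx with h | h
  · rw [hf.left _ h, hf.left _ (by linarith), sub_zero]
  · rw [hf.right _ (by linarith), hf.right _ (by linarith), sub_self]

lemma IsClamped.spikeMap_of_mem (hf : IsClamped f) {i : ι} {x : ℝ}
    (hx : x ∈ Icc (S.lower (S.v i)) (S.lower (S.v i) + S.g i)) :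
    S.spikeMap f x = S.v i + S.H i * (f (S.phase i x) - f (S.phase i x - 1)) := by
  have hx' : x ∈ Icc (0 : ℝ) 1 :=
    ⟨(S.lower_nonneg (S.v_pos i).le).trans hx.1, hx.2.trans (by
      rw [← S.upper_v]; exact S.upper_le_one (S.v_lt_one i).le)⟩
  rw [spikeMap, S.base_eq hx' hx.1 (by rw [S.upper_v]; exact hx.2), tsum_eq_single i]
  intro j hj
  rw [hf.spike_eq_zero (S.notMem_gap_of_mem_Icc hj.symm hx), mul_zero]

lemma IsClamped.spikeMap_of_notMem (hf : IsClamped f) {x : ℝ} (hx : ∀ i, x ∉ S.gap i) :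
    S.spikeMap f x = S.base x := by
  simp [spikeMap, hf.spike_eq_zero (hx _)]

/-- The spikes have disjoint supports and only finitely many reach height `ε`, so a finite partial
sum is uniformly within `ε`. -/
lemma IsClamped.continuous_spikeMap (hf : IsClamped f) (hc : Continuous f) :
    Continuous (S.spikeMap f) := by
  refine S.continuous_base.add (continuous_of_uniform_approx_of_continuous fun u hu => ?_)
  obtain ⟨ε, hε, hu⟩ := Metric.mem_uniformity_dist.1 hu
  have hfin : ∀ᶠ i in cofinite, |S.H i| < ε := by
    have := S.H_tendsto.abs
    rw [abs_zero] at this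
    exact this.eventually (eventually_lt_nhds hε)
  have hfin : {i | ¬ |S.H i| < ε}.Finite := hfin
  refine ⟨fun x => ∑ i ∈ hfin.toFinset, S.H i * (f (S.phase i x) - f (S.phase i x - 1)), ?_, ?_⟩
  · unfold phase
    fun_prop
  · intro x
    apply hu
    rw [Real.dist_eq]
    beta_reduce
    by_cases hx : ∃ i, x ∈ S.gap i
    · obtain ⟨i, hi⟩ := hx
      have h0 : ∀ j, j ≠ i → S.H j * (f (S.phase j x) - f (S.phase j x - 1)) = 0 := fun j hj => by
        rw [hf.spike_eq_zero (S.notMem_gap_of_mem_Icc hj.symm (Ioo_subset_Icc_self hi)), mul_zero]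
      rw [tsum_eq_single i h0]
      by_cases hiF : i ∈ hfin.toFinset
      · rw [Finset.sum_eq_single i (fun j _ => h0 j) (fun h => absurd hiF h), sub_self, abs_zero]
        exact hε
      · rw [Finset.sum_eq_zero fun j hj => h0 j (by rintro rfl; exact hiF hj), sub_zero, abs_mul]
        have h1 : |S.H i| < ε := by simpa using hiF
        have h2 := hf.sub_mem (S.phase i x)
        rw [abs_of_nonneg h2.1]
        exact (mul_le_of_le_one_right (abs_nonneg _) h2.2).trans_lt h1
    · push Not at hx
      simp [hf.spike_eq_zero (hx _), hε]

lemma IsClamped.isClamped_spikeMap (hf : IsClamped f) : IsClamped (S.spikeMap f) where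
  mem x := by
    by_cases hx : ∃ i, x ∈ S.gap i
    · obtain ⟨i, hi⟩ := hx
      rw [hf.spikeMap_of_mem (Ioo_subset_Icc_self hi)]
      have h2 := hf.sub_mem (S.phase i x)
      have := S.range_low i
      have := S.range_high i
      have := S.v_pos i
      have := S.v_lt_one i
      constructor <;> nlinarith [h2.1, h2.2]
    · push Not at hx
      rw [hf.spikeMap_of_notMem hx]
      exact S.base_mem x
  left x hx := by
    rw [hf.spikeMap_of_notMem fun i hi => ?_, S.base_of_nonpos hx]
    linarith [S.lower_nonneg (S.v_pos i).le, hi.1]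
  right x hx := by
    rw [hf.spikeMap_of_notMem fun i hi => ?_, S.base_of_one_le hx]
    have := S.upper_le_one (S.v_lt_one i).le
    rw [S.upper_v] at this
    linarith [hi.2]

/-- At each point only one spike is active, and in it only one copy of `f`, scaled by `|H i| ≤ 1/2`.
-/
lemma IsClamped.abs_spikeMap_sub_le {f' : ℝ → ℝ} (hf : IsClamped f) (hf' : IsClamped f') {C : ℝ}
    (hC : ∀ x, |f x - f' x| ≤ C) (x : ℝ) : |S.spikeMap f x - S.spikeMap f' x| ≤ 1 / 2 * C := by
  have hC0 : 0 ≤ C := (abs_nonneg _).trans (hC 0)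
  by_cases hx : ∃ i, x ∈ S.gap i
  · obtain ⟨i, hi⟩ := hx
    rw [hf.spikeMap_of_mem (Ioo_subset_Icc_self hi), hf'.spikeMap_of_mem (Ioo_subset_Icc_self hi),
      add_sub_add_left_eq_sub, ← mul_sub, abs_mul]
    have h1 : |f (S.phase i x) - f (S.phase i x - 1) -
        (f' (S.phase i x) - f' (S.phase i x - 1))| ≤ C := by
      rcases le_total (S.phase i x) 1 with h | h
      · rw [hf.left (S.phase i x - 1) (by linarith), hf'.left (S.phase i x - 1) (by linarith)]
        simpa using hC (S.phase i x)
      · rw [hf.right (S.phase i x) h, hf'.right (S.phase i x) h, sub_sub_sub_cancel_left,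
          abs_sub_comm]
        exact hC _
    exact mul_le_mul (S.abs_H_le i) h1 (abs_nonneg _) (by norm_num)
  · push Not at hx
    rw [hf.spikeMap_of_notMem hx, hf'.spikeMap_of_notMem hx, sub_self, abs_zero]
    positivity

variable (S)

/-- Banach's fixed point theorem on the closed set of clamped bounded continuous functions. The
extension of the operator by the identity outside this set plays no role. -/
theorem exists_fixed : ∃ f : ℝ → ℝ, Continuous f ∧ IsClamped f ∧ S.spikeMap f = f := by
  classical
  set A : Set (BoundedContinuousFunction ℝ ℝ) := {f | IsClamped f} with hA
  have hclosed : IsClosed A := by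
    have : A = (⋂ x : ℝ, {f | f x ∈ Icc (0 : ℝ) 1}) ∩ (⋂ x : Iic (0 : ℝ), {f | f x = 0}) ∩
        (⋂ x : Ici (1 : ℝ), {f | f x = 1}) := by
      ext f
      simp only [hA, mem_inter_iff, mem_iInter, mem_ofPred_eq, Subtype.forall, mem_Iic, mem_Ici]
      exact ⟨fun h => ⟨⟨h.mem, h.left⟩, h.right⟩, fun h => ⟨h.1.1, h.1.2, h.2⟩⟩
    rw [this]
    have hev : ∀ x : ℝ, Continuous fun f : BoundedContinuousFunction ℝ ℝ => f x := fun x =>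
      continuous_eval_const x
    refine ((isClosed_iInter fun x => ?_).inter (isClosed_iInter fun x => ?_)).inter
      (isClosed_iInter fun x => ?_)
    · exact isClosed_Icc.preimage (hev x)
    · exact isClosed_eq (hev x) continuous_const
    · exact isClosed_eq (hev x) continuous_const
  have hbdd : ∀ f : ℝ → ℝ, IsClamped f → ∀ x y, dist (f x) (f y) ≤ 1 := fun f hf x y =>
    Real.dist_le_of_mem_Icc_01 (hf.mem x) (hf.mem y)
  set T : BoundedContinuousFunction ℝ ℝ → BoundedContinuousFunction ℝ ℝ := fun f =>
    if h : IsClamped f then BoundedContinuousFunction.mkOfBound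
      ⟨S.spikeMap f, h.continuous_spikeMap f.continuous⟩ 1 (hbdd _ h.isClamped_spikeMap) else f
    with hT
  have hTf : ∀ f : BoundedContinuousFunction ℝ ℝ, IsClamped f → (T f : ℝ → ℝ) = S.spikeMap f := by
    intro f hf
    simp only [hT, dif_pos hf]
    rfl
  have hmaps : MapsTo T A A := by
    intro f hf
    change IsClamped (T f)
    rw [hTf f hf]
    exact hf.isClamped_spikeMap
  have hcontr : ContractingWith (1 / 2) (hmaps.restrict T A A) := by
    refine ⟨by rw [← NNReal.coe_lt_coe]; norm_num, LipschitzWith.of_dist_le_mul fun f f' => ?_⟩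
    rw [Subtype.dist_eq, Subtype.dist_eq]
    refine (BoundedContinuousFunction.dist_le (by positivity)).2 fun x => ?_
    rw [MapsTo.val_restrict_apply, MapsTo.val_restrict_apply, hTf _ f.2, hTf _ f'.2, Real.dist_eq]
    refine (f.2.abs_spikeMap_sub_le f'.2 (C := dist f.1 f'.1) (fun y => ?_) x).trans (by simp)
    rw [← Real.dist_eq]
    exact BoundedContinuousFunction.dist_coe_le_dist y
  have h0 : IsClamped fun x => ((projIcc (0 : ℝ) 1 zero_le_one x : Icc (0 : ℝ) 1) : ℝ) :=
    ⟨fun x => (projIcc (0 : ℝ) 1 zero_le_one x).2, fun x hx => by rw [projIcc_of_le_left _ hx],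
      fun x hx => by rw [projIcc_of_right_le _ hx]⟩
  set f₀ : BoundedContinuousFunction ℝ ℝ := BoundedContinuousFunction.mkOfBound
    ⟨fun x => ((projIcc (0 : ℝ) 1 zero_le_one x : Icc (0 : ℝ) 1) : ℝ),
      continuous_subtype_val.comp continuous_projIcc⟩ 1 (hbdd _ h0)
  obtain ⟨f, hf, hfix, -⟩ := hcontr.exists_fixedPoint' hclosed.isComplete hmaps (x := f₀) h0
    (edist_ne_top _ _)
  refine ⟨f, f.continuous, hf, ?_⟩
  rw [← hTf f hf, hfix]

end SpikeSystem

/-! ### The fixed point is a spike function -/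

namespace SpikeSystem
variable {ι : Type*} {S : SpikeSystem ι} {f : ℝ → ℝ}

lemma upper_notMem_gap (i : ι) (y : ℝ) : S.upper y ∉ S.gap i := by
  rintro ⟨h1, h2⟩
  rw [← S.upper_v] at h2
  rcases lt_or_ge y (S.v i) with h | h
  · linarith [S.upper_lt_lower h]
  · linarith [S.upper_mono h]

lemma lower_notMem_gap (i : ι) (y : ℝ) : S.lower y ∉ S.gap i := by
  rintro ⟨h1, h2⟩
  rw [← S.upper_v] at h2
  rcases lt_trichotomy y (S.v i) with h | rfl | h
  · linarith [S.upper_lt_lower h, S.lower_le_upper y]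
  · exact lt_irrefl _ h1
  · linarith [S.upper_lt_lower h]

lemma phase_left (i : ι) (s : ℝ) : S.phase i (S.lower (S.v i) + S.g i / 2 * s) = s := by
  have := S.g_pos i
  unfold phase
  field_simp
  ring

lemma phase_right (i : ι) (s : ℝ) :
    S.phase i (S.lower (S.v i) + S.g i / 2 + S.g i / 2 * s) = 1 + s := by
  have := S.g_pos i
  unfold phase
  field_simp
  ring

/-- The indicator of `v i ≤ y` is at most `y / v i`; this is where summability of `g i / v i`
enters. It gives linear growth of `f` at the endpoints. -/
lemma upper_le_mul (S : SpikeSystem ι) {y : ℝ} (hy : 0 ≤ y) :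
    S.upper y ≤ (1 + ∑' i, S.g i / S.v i) * y := by
  have : ∑' i, S.g i * ((if S.v i ≤ y then 1 else 0) - S.fill i y) ≤ ∑' i, S.g i / S.v i * y := by
    refine Summable.tsum_le_tsum (fun i => ?_) (S.summable_upper y) (S.summable_left.mul_right _)
    have h0 := S.v_pos i
    have h1 := S.g_pos i
    have h2 := S.fill_nonneg i y
    rw [div_mul_eq_mul_div, mul_div_assoc]
    gcongr
    split_ifs with h
    · linarith [(one_le_div h0).2 h]
    · linarith [div_nonneg hy h0.le]
  rw [tsum_mul_right] at this
  unfold upper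
  linarith

lemma one_sub_lower_le_mul (S : SpikeSystem ι) {y : ℝ} (hy : y ≤ 1) :
    1 - S.lower y ≤ (1 + ∑' i, S.g i / (1 - S.v i)) * (1 - y) := by
  rw [← S.upper_flip]
  exact S.flip.upper_le_mul (sub_nonneg.2 hy)

lemma IsClamped.base_div_two_le (hf : IsClamped f) (hfix : S.spikeMap f = f) (x : ℝ) :
    S.base x / 2 ≤ f x ∧ (1 - S.base x) / 2 ≤ 1 - f x := by
  by_cases hx : ∃ i, x ∈ S.gap i
  · obtain ⟨i, hi⟩ := hx
    have hb : S.base x = S.v i := S.base_eq (S.gap_subset i hi) hi.1.le (by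
      rw [S.upper_v]; exact hi.2.le)
    have h1 := hf.sub_mem (S.phase i x)
    have h2 := S.range_low i
    have h3 := S.range_high i
    have h4 := S.v_pos i
    have h5 := S.v_lt_one i
    have h6 : f x = S.v i + S.H i * (f (S.phase i x) - f (S.phase i x - 1)) := by
      rw [← hf.spikeMap_of_mem (Ioo_subset_Icc_self hi), hfix]
    rw [h6, hb]
    constructor <;> nlinarith [h1.1, h1.2]
  · push Not at hx
    have h6 : f x = S.base x := by rw [← hf.spikeMap_of_notMem hx, hfix]
    have := S.base_mem x
    rw [h6]
    constructor <;> linarith [this.1, this.2]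

theorem IsClamped.isSpikeFunction (hf : IsClamped f) (hfix : S.spikeMap f = f) :
    S.IsSpikeFunction f S.lower S.upper where
  f_zero := hf.left 0 le_rfl
  f_one := hf.right 1 le_rfl
  f_mem x _ := hf.mem x
  bound := by
    have hA : 0 ≤ ∑' i, S.g i / S.v i :=
      tsum_nonneg fun i => div_nonneg (S.g_pos i).le (S.v_pos i).le
    have hB : 0 ≤ ∑' i, S.g i / (1 - S.v i) :=
      tsum_nonneg fun i => div_nonneg (S.g_pos i).le (sub_nonneg.2 (S.v_lt_one i).le)
    refine ⟨1 / (2 * (1 + ∑' i, S.g i / S.v i + ∑' i, S.g i / (1 - S.v i))), by positivity,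
      fun x hx => ?_⟩
    have h1 := S.lower_base_le x
    have h2 := S.le_upper_base x
    rw [projIcc_of_mem _ hx] at h1 h2
    have h3 := S.upper_le_mul (S.base_mem x).1
    have h4 := S.one_sub_lower_le_mul (S.base_mem x).2
    obtain ⟨h5, h6⟩ := hf.base_div_two_le hfix x
    have h7 := mul_nonneg hB (S.base_mem x).1
    have h8 := mul_nonneg hA (sub_nonneg.2 (S.base_mem x).2)
    constructor
    · refine le_trans ?_ h5
      rw [one_div_mul_eq_div, div_le_div_iff₀ (by positivity) two_pos]
      linarith
    · refine le_trans ?_ h6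
      rw [one_div_mul_eq_div, div_le_div_iff₀ (by positivity) two_pos]
      linarith
  f_upper y hy := by
    rw [← hfix, hf.spikeMap_of_notMem fun i => upper_notMem_gap i y, S.base_upper hy]
  f_lower y hy := by
    rw [← hfix, hf.spikeMap_of_notMem fun i => lower_notMem_gap i y, S.base_lower hy]
  upper_v := S.upper_v
  upper_eq_lower y hy := S.upper_eq_lower hy
  lower_zero := S.lower_zero
  upper_one := S.upper_one
  le_gap y z h := S.le_gap h
  gap_le y z h := S.gap_le h
  left_piece i s hs := by
    have hg := S.g_pos i
    conv_lhs => rw [← hfix]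
    rw [hf.spikeMap_of_mem (i := i) ⟨by nlinarith [hs.1], by nlinarith [hs.2]⟩, phase_left,
      hf.left (s - 1) (by linarith [hs.2]), sub_zero]
  right_piece i s hs := by
    have hg := S.g_pos i
    conv_lhs => rw [← hfix]
    rw [hf.spikeMap_of_mem (i := i) ⟨by nlinarith [hs.1], by nlinarith [hs.2]⟩, phase_right,
      hf.right (1 + s) (by linarith [hs.1]), add_sub_cancel_left]
  cover x hx := by
    by_cases h : ∃ i, x ∈ S.gap i
    · exact Or.inr h
    · push Not at h
      left
      obtain ⟨y, hy, h1, h2⟩ := S.exists_lower_le_upper hx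
      refine ⟨y, hy, ?_⟩
      by_cases hr : y ∈ range S.v
      · obtain ⟨i, rfl⟩ := hr
        by_contra! h3
        refine h i ⟨lt_of_le_of_ne h1 h3.1.symm, ?_⟩
        rw [← S.upper_v]
        exact lt_of_le_of_ne h2 h3.2
      · rw [S.upper_eq_lower hr] at h2
        exact Or.inl (le_antisymm h2 h1)

/-! ### The distribution function of the fixed point -/

lemma intervalIntegrable_ite {p : ℝ → Prop} [DecidablePred p] (hp : MeasurableSet {x | p x})
    (a b : ℝ) : IntervalIntegrable (fun x => if p x then (1 : ℝ) else 0) volume a b := by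
  have : Measurable fun x => if p x then (1 : ℝ) else 0 :=
    Measurable.ite hp measurable_const measurable_const
  refine (intervalIntegrable_const (c := (1 : ℝ))).mono_fun this.aestronglyMeasurable ?_
  refine Eventually.of_forall fun x => ?_
  dsimp only
  split_ifs <;> simp

/-- The Lebesgue measure of the part of `[0, 1]` on which `f` is at most `y`. -/
noncomputable def subMeasure (f : ℝ → ℝ) (y : ℝ) : ℝ :=
  ∫ x in (0 : ℝ)..1, if f x ≤ y then (1 : ℝ) else 0

lemma subMeasure_nonneg (y : ℝ) : 0 ≤ subMeasure f y :=
  intervalIntegral.integral_nonneg zero_le_one fun x _ => by split_ifs <;> norm_num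

lemma subMeasure_mono (hc : Continuous f) {y z : ℝ} (h : y ≤ z) :
    subMeasure f y ≤ subMeasure f z := by
  refine intervalIntegral.integral_mono_on zero_le_one
    (intervalIntegrable_ite (measurableSet_le hc.measurable measurable_const) _ _)
    (intervalIntegrable_ite (measurableSet_le hc.measurable measurable_const) _ _) fun x _ => ?_
  split_ifs <;> linarith

lemma subMeasure_of_one_le (hf : IsClamped f) {y : ℝ} (h : 1 ≤ y) : subMeasure f y = 1 := by
  have : ∀ x, f x ≤ y := fun x => (hf.mem x).2.trans h
  simp [subMeasure, this]

lemma subMeasure_of_neg (hf : IsClamped f) {y : ℝ} (h : y < 0) : subMeasure f y = 0 := by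
  have : ∀ x, ¬ f x ≤ y := fun x => not_le.2 (h.trans_le (hf.mem x).1)
  simp [subMeasure, this]

/-- If the distribution function of `f` is uniformly close to that of Lebesgue measure, then so are
those of its affine images. -/
lemma abs_integral_affine_sub_le (hf : IsClamped f) (hc : Continuous f) {ε : ℝ}
    (hε : ∀ y ∈ Icc (0 : ℝ) 1, |subMeasure f y - y| ≤ ε) {c k : ℝ} (hk : k ≠ 0) (y : ℝ) :
    |(∫ s in (0 : ℝ)..1, if c + k * f s ≤ y then (1 : ℝ) else 0) -
      max 0 (min 1 ((y - min c (c + k)) / |k|))| ≤ ε := by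
  have hε0 : 0 ≤ ε := (abs_nonneg _).trans (hε 0 (by simp))
  rcases hk.lt_or_gt with hk | hk
  · have h1 : ∀ s, (if c + k * f s ≤ y then (1 : ℝ) else 0) =
        1 - if f s < (y - c) / k then 1 else 0 := by
      intro s
      have : c + k * f s ≤ y ↔ ¬ f s < (y - c) / k := by
        rw [not_lt, div_le_iff_of_neg hk]
        constructor <;> intro h <;> linarith
      by_cases h : f s < (y - c) / k <;> simp [this, h]
    have h2 : (y - min c (c + k)) / |k| = 1 - (y - c) / k := by
      rw [min_eq_right (by linarith), abs_of_neg hk]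
      field_simp
      ring
    have hint : ∀ u, IntervalIntegrable (fun s => if f s < u then (1 : ℝ) else 0) volume 0 1 :=
      fun u => intervalIntegrable_ite (measurableSet_lt hc.measurable measurable_const) _ _
    simp only [h1]
    rw [intervalIntegral.integral_sub intervalIntegrable_const (hint _), h2]
    simp only [intervalIntegral.integral_const, sub_zero, smul_eq_mul, mul_one]
    generalize (y - c) / k = u
    rcases le_or_gt u 0 with hu | hu
    · have : ∀ s, ¬ f s < u := fun s => not_lt.2 (hu.trans (hf.mem s).1)
      simp only [this, if_false]
      rw [min_eq_left (by linarith)]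
      simpa using hε0
    rcases lt_or_ge 1 u with hu1 | hu1
    · have : ∀ s, f s < u := fun s => (hf.mem s).2.trans_lt hu1
      simp only [this, if_true]
      rw [max_eq_left ((min_le_right _ _).trans (by linarith))]
      simpa using hε0
    · rw [min_eq_right (by linarith), max_eq_right (by linarith)]
      have h3 : ∫ s in (0 : ℝ)..1, (if f s < u then (1 : ℝ) else 0) ≤ subMeasure f u := by
        refine intervalIntegral.integral_mono_on zero_le_one (hint u)
          (intervalIntegrable_ite (measurableSet_le hc.measurable measurable_const) _ _)
          fun x _ => ?_
        split_ifs <;> linarith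
      -- The orientation reversal turns `≤` into `<`, whereas `hε` controls `f ≤ w`. The lower bound
      -- for `f < u` is obtained by letting `w` increase to `u`.
      have h4 : ∀ w, 0 ≤ w → w < u →
          w - ε ≤ ∫ s in (0 : ℝ)..1, (if f s < u then (1 : ℝ) else 0) := by
        intro w hw hwu
        have h5 : subMeasure f w ≤ ∫ s in (0 : ℝ)..1, (if f s < u then (1 : ℝ) else 0) := by
          refine intervalIntegral.integral_mono_on zero_le_one
            (intervalIntegrable_ite (measurableSet_le hc.measurable measurable_const) _ _) (hint u)
            fun x _ => ?_
          split_ifs <;> linarith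
        linarith [(abs_le.1 (hε w ⟨hw, by linarith⟩)).1]
      have h6 : u - ε ≤ ∫ s in (0 : ℝ)..1, (if f s < u then (1 : ℝ) else 0) := by
        refine le_of_forall_lt_imp_le_of_dense fun a ha => ?_
        rcases le_or_gt 0 (a + ε) with h | h
        · linarith [h4 (a + ε) h (by linarith)]
        · linarith [h4 0 le_rfl hu]
      have h7 := (abs_le.1 (hε u ⟨hu.le, hu1⟩)).2
      rw [abs_le]
      constructor <;> linarith
  · have h1 : ∀ s, c + k * f s ≤ y ↔ f s ≤ (y - c) / k := by
      intro s
      rw [le_div_iff₀ hk]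
      constructor <;> intro h <;> linarith
    have h2 : (y - min c (c + k)) / |k| = (y - c) / k := by
      rw [min_eq_left (by linarith), abs_of_pos hk]
    simp only [h1]
    rw [h2]
    generalize (y - c) / k = u
    change |subMeasure f u - _| ≤ ε
    rcases lt_or_ge u 0 with hu | hu
    · rw [subMeasure_of_neg hf hu, max_eq_left ((min_le_right _ _).trans hu.le)]
      simpa using hε0
    rcases le_or_gt 1 u with hu1 | hu1
    · rw [subMeasure_of_one_le hf hu1, min_eq_left hu1]
      simpa using hε0
    · rw [min_eq_right hu1.le, max_eq_right hu]
      exact hε u ⟨hu, hu1.le⟩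

lemma countable_index (S : SpikeSystem ι) : Countable ι := by
  rw [← Set.countable_univ_iff]
  convert S.summable_g.countable_support
  ext i
  simp [(S.g_pos i).ne']

lemma pairwise_disjoint_gap (S : SpikeSystem ι) : Pairwise (Function.onFun Disjoint S.gap) :=
  fun _ _ hij => Set.disjoint_left.2 fun _ hx =>
    S.notMem_gap_of_mem_Icc hij (Ioo_subset_Icc_self hx)

lemma tsum_g_le (S : SpikeSystem ι) : ∑' i, S.g i ≤ 1 / 2 := by
  refine (Summable.tsum_le_tsum S.g_le_ratio S.summable_g (S.summable_ratio.div_const 2)).trans ?_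
  rw [tsum_div_const]
  linarith [S.tsum_ratio_le]

lemma integral_gap (hf : IsClamped f) (hfix : S.spikeMap f = f) (hc : Continuous f) (i : ι)
    (y : ℝ) :
    ∫ x in S.gap i, (if f x ≤ y then (1 : ℝ) else 0) = S.g i / 2 *
      ((∫ s in (0 : ℝ)..1, if S.v i + S.H i * f s ≤ y then (1 : ℝ) else 0) +
        ∫ s in (0 : ℝ)..1, if S.v i + S.H i + -S.H i * f s ≤ y then (1 : ℝ) else 0) := by
  have hg := S.g_pos i
  have h := hf.isSpikeFunction hfix
  have hint : ∀ a b, IntervalIntegrable (fun x => if f x ≤ y then (1 : ℝ) else 0) volume a b :=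
    fun a b => intervalIntegrable_ite (measurableSet_le hc.measurable measurable_const) a b
  rw [gap, ← integral_Ioc_eq_integral_Ioo, ← intervalIntegral.integral_of_le (by linarith),
    ← intervalIntegral.integral_add_adjacent_intervals (hint _ (S.lower (S.v i) + S.g i / 2))
      (hint _ _)]
  have key : ∀ α {c k : ℝ}, (∀ s ∈ Icc (0 : ℝ) 1, f (α + S.g i / 2 * s) = c + k * f s) →
      ∫ x in α..(α + S.g i / 2), (if f x ≤ y then (1 : ℝ) else 0) =
        S.g i / 2 * ∫ s in (0 : ℝ)..1, if c + k * f s ≤ y then (1 : ℝ) else 0 := by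
    intro α c k hα
    have h1 := intervalIntegral.mul_integral_comp_add_mul (a := 0) (b := 1)
      (f := fun x => if f x ≤ y then (1 : ℝ) else 0) (S.g i / 2) α
    simp only [mul_zero, add_zero, mul_one] at h1
    rw [← h1]
    congr 1
    refine intervalIntegral.integral_congr fun s hs => ?_
    rw [uIcc_of_le zero_le_one] at hs
    simp only [hα s hs]
  have h2 := key _ (c := S.v i + S.H i) (k := -S.H i) fun s hs => by
      rw [h.right_piece i s hs]; ring
  rw [key _ (h.left_piece i), mul_add, ← h2]
  congr 2
  ring

/-- The defect of the distribution function of a spike function, in terms of the spikes. -/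
lemma subMeasure_sub (hf : IsClamped f) (hfix : S.spikeMap f = f) (hc : Continuous f) {y : ℝ}
    (hy : y ∈ Icc (0 : ℝ) 1) :
    HasSum (fun i => (∫ x in S.gap i, (if f x ≤ y then (1 : ℝ) else 0)) - S.g i * S.fill i y)
      (subMeasure f y - y) := by
  have := S.countable_index
  have hu0 : 0 ≤ S.upper y := (S.lower_nonneg hy.1).trans (S.lower_le_upper y)
  have hu1 : S.upper y ≤ 1 := S.upper_le_one hy.2
  set φ : ℝ → ℝ := fun x => if f x ≤ y then 1 else 0 with hφ
  -- This is the indicator for the increasing part alone. It agrees with `φ` off the gaps, where `f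
  -- = base`, so the difference of the integrals is a sum over gaps.
  set ψ : ℝ → ℝ := fun x => if x ≤ S.upper y then 1 else 0 with hψ
  have hφi : ∀ a b, IntervalIntegrable φ volume a b :=
    intervalIntegrable_ite (measurableSet_le hc.measurable measurable_const)
  have hψi : ∀ a b, IntervalIntegrable ψ volume a b :=
    intervalIntegrable_ite (measurableSet_le measurable_id measurable_const)
  have hon : ∀ i, IntegrableOn φ (S.gap i) ∧ IntegrableOn ψ (S.gap i) := fun i =>
    ⟨((intervalIntegrable_iff_integrableOn_Ioo_of_le (by linarith [S.g_pos i])).1 (hφi _ _)),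
      ((intervalIntegrable_iff_integrableOn_Ioo_of_le (by linarith [S.g_pos i])).1 (hψi _ _))⟩
  have hint : IntegrableOn (fun x => φ x - ψ x) (Icc 0 1) := by
    have := (intervalIntegrable_iff_integrableOn_Icc_of_le zero_le_one).1 ((hφi 0 1).sub (hψi 0 1))
    exact this
  have hψ1 : ∫ x in (0 : ℝ)..1, ψ x = S.upper y := by
    rw [← intervalIntegral.integral_add_adjacent_intervals (hψi 0 (S.upper y)) (hψi _ 1),
      intervalIntegral.integral_congr (g := fun _ => 1) (a := 0),
      intervalIntegral.integral_congr_ae (g := fun _ => 0) (a := S.upper y)]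
    · simp
    · refine Eventually.of_forall fun x hx => ?_
      rw [uIoc_of_le hu1] at hx
      simp [hψ, hx.1]
    · intro x hx
      rw [uIcc_of_le hu0] at hx
      simp [hψ, hx.2]
  have hmeas : ∀ i, MeasurableSet (S.gap i) := fun i => measurableSet_Ioo
  have hgapψ : ∀ i, ∫ x in S.gap i, ψ x = S.g i * if S.v i ≤ y then 1 else 0 := by
    intro i
    have hg := S.g_pos i
    rw [setIntegral_congr_fun (g := fun _ => if S.v i ≤ y then (1 : ℝ) else 0) (hmeas i)]
    · simp [gap, hg.le]
    · intro x hx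
      have hx2 := hx.2
      rw [← S.upper_v] at hx2
      by_cases h : S.v i ≤ y
      · have := S.upper_mono h
        simp only [hψ, if_pos h, if_pos (hx2.le.trans this)]
      · have := S.upper_lt_lower (not_le.1 h)
        simp only [hψ, if_neg h, if_neg (not_le.2 (this.trans hx.1))]
  have hsub : (⋃ i, S.gap i) ⊆ Icc 0 1 := iUnion_subset S.gap_subset
  have hzero : ∀ x ∈ Icc (0 : ℝ) 1 \ ⋃ i, S.gap i, φ x - ψ x = 0 := by
    rintro x ⟨hx, hxg⟩
    have hxg' : ∀ i, x ∉ S.gap i := by simpa using hxg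
    have hfx : f x = S.base x := by rw [← hf.spikeMap_of_notMem hxg', hfix]
    have h1 := S.lower_base_le x
    have h2 := S.le_upper_base x
    rw [projIcc_of_mem _ hx] at h1 h2
    have : f x ≤ y ↔ x ≤ S.upper y := by
      rw [hfx]
      exact ⟨fun h => h2.trans (S.upper_mono h), fun h => S.le_of_lower_le_upper (h1.trans h)⟩
    simp [hφ, hψ, this]
  have htot : ∫ x in ⋃ i, S.gap i, (φ x - ψ x) = subMeasure f y - S.upper y := by
    rw [← setIntegral_eq_of_subset_of_forall_sdiff_eq_zero measurableSet_Icc hsub hzero,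
      integral_Icc_eq_integral_Ioc, ← intervalIntegral.integral_of_le zero_le_one,
      intervalIntegral.integral_sub (hφi 0 1) (hψi 0 1), hψ1]
    rfl
  have h1 := hasSum_integral_iUnion (f := fun x => φ x - ψ x) hmeas S.pairwise_disjoint_gap
    (hint.mono_set hsub)
  rw [htot] at h1
  have h2 := (S.summable_upper y).hasSum
  have h3 := h1.add h2
  have h4 : S.upper y = y + ∑' i, S.g i * ((if S.v i ≤ y then 1 else 0) - S.fill i y) := rfl
  rw [show subMeasure f y - S.upper y + _ = subMeasure f y - y by rw [h4]; ring] at h3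
  have h5 : (fun i => (∫ x in S.gap i, φ x) - S.g i * S.fill i y) = fun i =>
      (∫ x in S.gap i, (φ x - ψ x)) + S.g i * ((if S.v i ≤ y then 1 else 0) - S.fill i y) := by
    ext i
    rw [integral_sub (hon i).1 (hon i).2, hgapψ]
    ring
  rw [h5]
  exact h3

/-- A uniform bound `ε` on the defect passes to both copies in every spike, and summing over the
spikes gives `ε * ∑ g i ≤ ε / 2`; start from the trivial bound `1` and iterate. -/
theorem subMeasure_eq (hf : IsClamped f) (hfix : S.spikeMap f = f) (hc : Continuous f) {y : ℝ}
    (hy : y ∈ Icc (0 : ℝ) 1) : subMeasure f y = y := by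
  have key : ∀ n : ℕ, ∀ y ∈ Icc (0 : ℝ) 1, |subMeasure f y - y| ≤ (1 / 2 : ℝ) ^ n := by
    intro n
    induction n with
    | zero =>
      intro y hy
      have h1 := subMeasure_nonneg (f := f) y
      have h2 := subMeasure_mono hc hy.2
      rw [subMeasure_of_one_le hf le_rfl] at h2
      rw [pow_zero, abs_le]
      constructor <;> linarith [hy.1, hy.2]
    | succ n ih =>
      intro y hy
      have h1 := subMeasure_sub hf hfix hc hy
      have h2 : ∀ i, ‖(∫ x in S.gap i, (if f x ≤ y then (1 : ℝ) else 0)) - S.g i * S.fill i y‖ ≤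
          S.g i * (1 / 2 : ℝ) ^ n := by
        intro i
        have a1 := abs_integral_affine_sub_le hf hc ih (c := S.v i) (S.H_ne i) y
        have a2 := abs_integral_affine_sub_le hf hc ih (c := S.v i + S.H i)
          (neg_ne_zero.2 (S.H_ne i)) y
        rw [add_neg_cancel_right, min_comm (S.v i + S.H i), abs_neg] at a2
        change |_ - S.fill i y| ≤ _ at a1 a2
        rw [integral_gap hf hfix hc, Real.norm_eq_abs]
        have hg := S.g_pos i
        rw [abs_le] at a1 a2 ⊢
        constructor <;> nlinarith
      rw [← h1.tsum_eq, ← Real.norm_eq_abs]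
      refine (tsum_of_norm_bounded (S.summable_g.mul_right _).hasSum h2).trans ?_
      rw [tsum_mul_right, pow_succ, mul_comm]
      gcongr
      exact S.tsum_g_le
  have hlim := tendsto_pow_atTop_nhds_zero_of_lt_one (r := (1 / 2 : ℝ)) (by norm_num) (by norm_num)
  have := le_of_tendsto_of_tendsto' tendsto_const_nhds hlim fun n => key n y hy
  exact sub_eq_zero.1 (abs_nonpos_iff.1 this)

end SpikeSystem

/-! ### An explicit spike system on the rationals -/

/-- The heights of the spikes, as a function of the denominators of their positions. -/
noncomputable def spikeHeight (n : ℕ) : ℝ := 1 / (64 + (Nat.log 2 n : ℝ))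

lemma spikeHeight_pos (n : ℕ) : 0 < spikeHeight n := by
  unfold spikeHeight
  positivity

lemma spikeHeight_le (n : ℕ) : spikeHeight n ≤ 1 / 64 := by
  unfold spikeHeight
  gcongr
  simp

lemma spikeHeight_anti {m n : ℕ} (h : m ≤ n) : spikeHeight n ≤ spikeHeight m := by
  unfold spikeHeight
  gcongr

lemma spikeHeight_tendsto : Tendsto spikeHeight atTop (𝓝 0) := by
  have h : Tendsto (fun n : ℕ => 64 + (Nat.log 2 n : ℝ)) atTop atTop := by
    refine tendsto_atTop_add_const_left _ _ (tendsto_natCast_atTop_atTop.comp ?_)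
    refine tendsto_atTop.2 fun b => ?_
    filter_upwards [eventually_ge_atTop (2 ^ b)] with n hn
    exact Nat.le_log_of_pow_le (by norm_num) hn
  exact (tendsto_inv_atTop_zero.comp h).congr fun n => (one_div _).symm

/-- Logarithmic decay is slow enough that a spike whose denominator is `1024` times larger keeps
over three quarters of the height, even after moving by `1 / (1024 * n)`. This yields `cover_right`
and `cover_left`; the `64` is needed for small `n`, since `4 * 64 > 3 * (64 + 10)`. -/
lemma spikeHeight_mul {n : ℕ} (hn : n ≠ 0) :
    3 / 4 * spikeHeight n + 1 / (1024 * n) ≤ spikeHeight (1024 * n) := by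
  have hlog : Nat.log 2 (1024 * n) = Nat.log 2 n + 10 := by
    rw [show 1024 * n = n * 2 * 2 * 2 * 2 * 2 * 2 * 2 * 2 * 2 * 2 by ring]
    repeat rw [Nat.log_mul_base (by norm_num) (by positivity)]
  have h1 : ((Nat.log 2 n : ℕ) : ℝ) + 1 ≤ n := by
    have : Nat.log 2 n < n := Nat.log_lt_self 2 hn
    exact_mod_cast this
  unfold spikeHeight
  rw [hlog]
  push_cast
  have h0 : (0 : ℝ) ≤ (Nat.log 2 n : ℕ) := Nat.cast_nonneg _
  generalize ((Nat.log 2 n : ℕ) : ℝ) = e at *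
  have h2 : 1 / (1024 * (n : ℝ)) ≤ 1 / (1024 * (e + 1)) := by gcongr
  refine (add_le_add_right h2 _).trans ?_
  rw [mul_one_div, div_add_div _ _ (by positivity) (by positivity),
    div_le_div_iff₀ (by positivity) (by positivity)]
  nlinarith [mul_nonneg h0 h0, mul_nonneg (mul_nonneg h0 h0) h0]

/-- Rationals of denominator at most `n` are `1 / n`-dense, while their spikes have height of order
`1 / log n`. This is the source of `spike_right` and `spike_left`. -/
lemma spikeHeight_two_pow (A : ℝ) : ∀ᶠ k : ℕ in atTop, A * (1 / 2 ^ k) ≤ spikeHeight (2 ^ k) := by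
  have h1 : Tendsto (fun k : ℕ => |A| * (64 * ((1 / 2 : ℝ) ^ k) + k * (1 / 2 : ℝ) ^ k)) atTop
      (𝓝 (|A| * (64 * 0 + 0))) := by
    refine Tendsto.const_mul _ (Tendsto.add (Tendsto.const_mul _ ?_) ?_)
    · exact tendsto_pow_atTop_nhds_zero_of_lt_one (by norm_num) (by norm_num)
    · exact tendsto_self_mul_const_pow_of_lt_one (by norm_num) (by norm_num)
  rw [mul_zero, add_zero, mul_zero] at h1
  filter_upwards [h1.eventually (eventually_le_nhds one_pos)] with k hk
  unfold spikeHeight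
  rw [Nat.log_pow (by norm_num), le_div_iff₀ (by positivity)]
  refine le_trans ?_ hk
  calc _ = A * (64 * ((1 / 2 : ℝ) ^ k) + k * (1 / 2 : ℝ) ^ k) := by rw [one_div_pow]; ring
    _ ≤ _ := by gcongr; exact le_abs_self A

/-- The rational numbers between `0` and `1`. -/
abbrev UnitRat := {q : ℚ // 0 < q ∧ q < 1}

namespace UnitRat

lemma pos (q : UnitRat) : (0 : ℝ) < (q.1 : ℝ) := by exact_mod_cast q.2.1

lemma lt_one (q : UnitRat) : (q.1 : ℝ) < 1 := by exact_mod_cast q.2.2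

/-- The signed heights of the spikes: upwards on the lower half, downwards on the upper half. -/
noncomputable def height (q : UnitRat) : ℝ :=
  if q.1 ≤ 1 / 2 then spikeHeight q.1.den else -spikeHeight q.1.den

lemma abs_height (q : UnitRat) : |height q| = spikeHeight q.1.den := by
  unfold height
  split_ifs
  · exact abs_of_pos (spikeHeight_pos _)
  · rw [abs_neg, abs_of_pos (spikeHeight_pos _)]

lemma height_of_pos {q : UnitRat} (h : 0 < height q) :
    (q.1 : ℝ) ≤ 1 / 2 ∧ height q = spikeHeight q.1.den := by
  unfold height at *
  split_ifs at * with h1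
  · exact ⟨by simpa using (Rat.cast_le (K := ℝ)).2 h1, rfl⟩
  · linarith [spikeHeight_pos q.1.den]

lemma height_of_neg {q : UnitRat} (h : height q < 0) :
    1 / 2 < (q.1 : ℝ) ∧ height q = -spikeHeight q.1.den := by
  unfold height at *
  split_ifs at * with h1
  · linarith [spikeHeight_pos q.1.den]
  · exact ⟨by simpa using (Rat.cast_lt (K := ℝ)).2 (not_le.1 h1), rfl⟩

lemma finite_den_le (N : ℕ) : {q : UnitRat | q.1.den ≤ N}.Finite := by
  have : Set.InjOn (fun q : UnitRat => (q.1.num, q.1.den)) {q : UnitRat | q.1.den ≤ N} := by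
    intro q _ r _ h
    exact Subtype.ext (Rat.ext (Prod.ext_iff.1 h).1 (Prod.ext_iff.1 h).2)
  refine Set.Finite.of_finite_image (Set.Finite.subset
    ((Set.finite_Icc (0 : ℤ) N).prod (Set.finite_Icc 0 N)) ?_) this
  rintro _ ⟨q, hq, rfl⟩
  refine ⟨⟨(Rat.num_pos.2 q.2.1).le, ?_⟩, ⟨Nat.zero_le _, hq⟩⟩
  have h1 : q.1.num < q.1.den := Rat.num_lt_denom_iff.2 q.2.2
  have h2 : (q.1.den : ℤ) ≤ N := by exact_mod_cast hq
  exact (h1.trans_le h2).le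

lemma height_tendsto : Tendsto height cofinite (𝓝 0) := by
  rw [tendsto_zero_iff_abs_tendsto_zero]
  have h1 : Tendsto (fun q : UnitRat => q.1.den) cofinite atTop := by
    refine tendsto_atTop.2 fun b => ?_
    refine (finite_den_le b).subset fun q hq => ?_
    simp only [mem_compl_iff, mem_ofPred_eq, not_le] at hq ⊢
    exact hq.le
  refine (spikeHeight_tendsto.comp h1).congr fun q => (abs_height q).symm

lemma exists_den_dvd {n : ℕ} (hn : n ≠ 0) {a : ℤ} (h0 : 0 < a) (h1 : a < n) :
    ∃ q : UnitRat, (q.1 : ℝ) = a / n ∧ q.1.den ≤ n := by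
  have hn' : (0 : ℚ) < n := by positivity
  refine ⟨⟨(a : ℚ) / n, by positivity, ?_⟩, by push_cast; rfl, ?_⟩
  · rw [div_lt_one hn']; exact_mod_cast h1
  · have := Rat.den_dvd a n
    rw [Rat.divInt_eq_div] at this
    exact Nat.le_of_dvd (Nat.pos_of_ne_zero hn) (by exact_mod_cast this)

lemma eq_num_div_den (q : UnitRat) : (q.1 : ℝ) = q.1.num / q.1.den := Rat.cast_def q.1

lemma num_bounds (q : UnitRat) : 0 < q.1.num ∧ q.1.num < q.1.den :=
  ⟨Rat.num_pos.2 q.2.1, Rat.num_lt_denom_iff.2 q.2.2⟩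

lemma exists_right (q : UnitRat) : ∃ r : UnitRat,
    (r.1 : ℝ) = q.1 + 1 / (1024 * q.1.den) ∧ r.1.den ≤ 1024 * q.1.den := by
  have hd := q.1.den_pos
  obtain ⟨h1, h2⟩ := q.num_bounds
  obtain ⟨r, hr, hr'⟩ := exists_den_dvd (n := 1024 * q.1.den) (a := 1024 * q.1.num + 1) (by omega)
    (by omega) (by push_cast; omega)
  refine ⟨r, ?_, hr'⟩
  rw [hr, eq_num_div_den q]
  push_cast
  field_simp

lemma exists_left (q : UnitRat) : ∃ r : UnitRat,
    (r.1 : ℝ) = q.1 - 1 / (1024 * q.1.den) ∧ r.1.den ≤ 1024 * q.1.den := by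
  have hd := q.1.den_pos
  obtain ⟨h1, h2⟩ := q.num_bounds
  obtain ⟨r, hr, hr'⟩ := exists_den_dvd (n := 1024 * q.1.den) (a := 1024 * q.1.num - 1) (by omega)
    (by omega) (by push_cast; omega)
  refine ⟨r, ?_, hr'⟩
  rw [hr, eq_num_div_den q]
  push_cast
  field_simp

lemma exists_between_right {y : ℝ} (h0 : 0 ≤ y) {n : ℕ} (hn : n ≠ 0) (h1 : y + 1 / n < 1) :
    ∃ q : UnitRat, y < q.1 ∧ (q.1 : ℝ) ≤ y + 1 / n ∧ q.1.den ≤ n := by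
  have hn' : (0 : ℝ) < n := by positivity
  have hf0 : 0 ≤ ⌊y * n⌋ := Int.floor_nonneg.2 (by positivity)
  have hf1 := Int.floor_le (y * n)
  have hf2 := Int.lt_floor_add_one (y * n)
  have h2 : y * n + 1 < n := by
    have := mul_lt_mul_of_pos_right h1 hn'
    rw [add_mul, one_div, inv_mul_cancel₀ hn'.ne'] at this
    linarith
  obtain ⟨q, hq, hq'⟩ := exists_den_dvd hn (a := ⌊y * n⌋ + 1) (by omega) (by
    have : ((⌊y * n⌋ : ℤ) : ℝ) + 1 < n := by linarith
    exact_mod_cast this)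
  refine ⟨q, ?_, ?_, hq'⟩
  · rw [hq, lt_div_iff₀ hn']; push_cast; exact hf2
  · rw [hq, div_le_iff₀ hn', add_mul, one_div, inv_mul_cancel₀ hn'.ne']; push_cast; linarith

lemma exists_between_left {y : ℝ} {n : ℕ} (h0 : 0 < y - 1 / n) (hn : n ≠ 0) (h1 : y ≤ 1) :
    ∃ q : UnitRat, (q.1 : ℝ) < y ∧ y - 1 / n ≤ q.1 ∧ q.1.den ≤ n := by
  obtain ⟨q, hq1, hq2, hq3⟩ := exists_between_right (y := 1 - y) (by linarith) hn (by linarith)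
  obtain ⟨h2, h3⟩ := q.num_bounds
  obtain ⟨r, hr, hr'⟩ := exists_den_dvd (n := q.1.den) (a := q.1.den - q.1.num) (by omega)
    (by omega) (by omega)
  have hd : (0 : ℝ) < q.1.den := by exact_mod_cast q.1.den_pos
  have : (r.1 : ℝ) = 1 - q.1 := by
    rw [hr, eq_num_div_den q]; push_cast; field_simp
  exact ⟨r, by linarith, by linarith, hr'.trans hq3⟩

end UnitRat

theorem exists_spikeSystem : Nonempty (SpikeSystem UnitRat) := by
  obtain ⟨c, hc0, b, hcb, hb⟩ := posSumOfEncodable (ε := 1 / 2) (by norm_num) UnitRat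
  have hv0 := UnitRat.pos
  have hv1 := UnitRat.lt_one
  have hv1' : ∀ q : UnitRat, 0 < 1 - (q.1 : ℝ) := fun q => sub_pos.2 (hv1 q)
  have hH0 : ∀ q, 0 < |UnitRat.height q| := fun q => by
    rw [UnitRat.abs_height]; exact spikeHeight_pos _
  have hH1 : ∀ q, |UnitRat.height q| ≤ 1 / 64 := fun q => by
    rw [UnitRat.abs_height]; exact spikeHeight_le _
  have hcsum : ∀ u : UnitRat → ℝ, (∀ q, 0 < u q) → (∀ q, u q ≤ 1) →
      Summable fun q => c q * u q := fun u hu0 hu1 =>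
    Summable.of_nonneg_of_le (fun q => mul_nonneg (hc0 q).le (hu0 q).le)
      (fun q => mul_le_of_le_one_right (hc0 q).le (hu1 q)) hcb.summable
  have hratio : ∀ q : UnitRat, c q * (|UnitRat.height q| * (q.1 * (1 - q.1))) /
      |UnitRat.height q| = c q * (q.1 * (1 - q.1)) := fun q => by
    have := hH0 q
    field_simp
  have hvv : ∀ q : UnitRat, (q.1 : ℝ) * (1 - q.1) ≤ 1 := fun q => by nlinarith [hv0 q, hv1 q]
  have hscale : ∀ A δ₀ d : ℝ, 0 < δ₀ → 0 < d → ∃ n : ℕ, n ≠ 0 ∧ (1 / n : ℝ) < δ₀ ∧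
      (1 / n : ℝ) < d ∧ A * (1 / n) ≤ spikeHeight n := by
    intro A δ₀ d hδ hd
    have h1 : Tendsto (fun k : ℕ => (1 : ℝ) / 2 ^ k) atTop (𝓝 0) := by
      simpa [one_div_pow] using
        tendsto_pow_atTop_nhds_zero_of_lt_one (r := (1 / 2 : ℝ)) (by norm_num) (by norm_num)
    obtain ⟨k, ⟨h2, h3⟩, h4⟩ := (((h1.eventually (eventually_lt_nhds hδ)).and
      (h1.eventually (eventually_lt_nhds hd))).and (spikeHeight_two_pow A)).exists
    exact ⟨2 ^ k, by positivity, by exact_mod_cast h2, by exact_mod_cast h3, by exact_mod_cast h4⟩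
  refine ⟨{
    v := fun q => q.1
    -- The factor `|H|` cancels in `g / |H|`, leaving a sum at most `∑ c q ≤ 1/2`; the factors `q`
    -- and `1 - q` make `g / v` and `g / (1 - v)` summable.
    g := fun q => c q * (|UnitRat.height q| * (q.1 * (1 - q.1)))
    H := UnitRat.height
    v_pos := hv0
    v_lt_one := hv1
    v_injective := fun q r h => Subtype.ext (Rat.cast_injective h)
    g_pos := fun q => mul_pos (hc0 q) (mul_pos (hH0 q) (mul_pos (hv0 q) (hv1' q)))
    H_ne := fun q => abs_pos.1 (hH0 q)
    H_tendsto := UnitRat.height_tendsto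
    summable_ratio := ?_
    tsum_ratio_le := ?_
    summable_left := ?_
    summable_right := ?_
    range_low := ?_
    range_high := ?_
    spike_right := ?_
    spike_left := ?_
    low_of_neg := ?_
    high_of_pos := ?_
    cover_right := ?_
    cover_left := ?_ }⟩
  · simp only [hratio]
    exact hcsum _ (fun q => mul_pos (hv0 q) (hv1' q)) hvv
  · simp only [hratio]
    refine le_trans ?_ hb
    rw [← hcb.tsum_eq]
    exact Summable.tsum_le_tsum (fun q => mul_le_of_le_one_right (hc0 q).le (hvv q))
      (hcsum _ (fun q => mul_pos (hv0 q) (hv1' q)) hvv) hcb.summable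
  · refine (hcsum (fun q => |UnitRat.height q| * (1 - q.1))
      (fun q => mul_pos (hH0 q) (hv1' q)) fun q => ?_).congr fun q => ?_
    · nlinarith [hH0 q, hH1 q, hv0 q, hv1' q]
    · have := hv0 q
      field_simp
  · refine (hcsum (fun q => |UnitRat.height q| * q.1)
      (fun q => mul_pos (hH0 q) (hv0 q)) fun q => ?_).congr fun q => ?_
    · nlinarith [hH0 q, hH1 q, hv0 q, hv1 q]
    · have := hv1' q
      field_simp
  · intro q
    have h0 := hv0 q
    rcases (abs_pos.1 (hH0 q)).lt_or_gt with h | h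
    · have := (UnitRat.height_of_neg h).1
      linarith [(abs_le.1 (hH1 q)).1]
    · linarith
  · intro q
    have h0 := hv1 q
    rcases (abs_pos.1 (hH0 q)).lt_or_gt with h | h
    · linarith
    · have := (UnitRat.height_of_pos h).1
      linarith [(abs_le.1 (hH1 q)).2]
  · intro y h0 h1 A δ₀ hδ
    obtain ⟨n, hn, h2, h3, h4⟩ := hscale A δ₀ (1 - y) hδ (sub_pos.2 h1)
    obtain ⟨q, hq1, hq2, hq3⟩ := UnitRat.exists_between_right h0 hn (by linarith)
    refine ⟨1 / n, by positivity, h2, q, hq1, hq2, ?_⟩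
    rw [UnitRat.abs_height]
    exact h4.trans (spikeHeight_anti hq3)
  · intro y h0 h1 A δ₀ hδ
    obtain ⟨n, hn, h2, h3, h4⟩ := hscale A δ₀ y hδ h0
    obtain ⟨q, hq1, hq2, hq3⟩ := UnitRat.exists_between_left (sub_pos.2 h3) hn h1
    refine ⟨1 / n, by positivity, h2, q, hq1, hq2, ?_⟩
    rw [UnitRat.abs_height]
    exact h4.trans (spikeHeight_anti hq3)
  · intro q h
    linarith [(UnitRat.height_of_neg h).1, (abs_le.1 (hH1 q)).1]
  · intro q h
    linarith [(UnitRat.height_of_pos h).1, (abs_le.1 (hH1 q)).2]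
  · intro q h
    obtain ⟨hq1, hq2⟩ := UnitRat.height_of_neg h
    obtain ⟨r, hr, hr'⟩ := q.exists_right
    have hd : (0 : ℝ) < 1 / (1024 * q.1.den) := by have := q.1.den_pos; positivity
    -- The neighbour lies further right, hence also in the upper half, so its spike points downwards
    -- too.
    have h1 : UnitRat.height r = -spikeHeight r.1.den := by
      refine (UnitRat.height_of_neg ?_).2
      by_contra! h2
      linarith [(UnitRat.height_of_pos (lt_of_le_of_ne h2 (abs_pos.1 (hH0 r)).symm)).1]
    refine ⟨r, by linarith, ?_⟩
    have h2 := spikeHeight_mul q.1.den_nz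
    have h3 := spikeHeight_anti hr'
    rw [hr, h1, hq2]
    linarith
  · intro q h
    obtain ⟨hq1, hq2⟩ := UnitRat.height_of_pos h
    obtain ⟨r, hr, hr'⟩ := q.exists_left
    have hd : (0 : ℝ) < 1 / (1024 * q.1.den) := by have := q.1.den_pos; positivity
    have h1 : UnitRat.height r = spikeHeight r.1.den := by
      refine (UnitRat.height_of_pos ?_).2
      by_contra! h2
      linarith [(UnitRat.height_of_neg (lt_of_le_of_ne h2 (abs_pos.1 (hH0 r)))).1]
    refine ⟨r, by linarith, ?_⟩
    have h2 := spikeHeight_mul q.1.den_nz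
    have h3 := spikeHeight_anti hr'
    rw [hr, h1, hq2]
    linarith

/-! ### From oscillation to Dini derivatives -/

/-- A family of real numbers that is frequently large in absolute value, but frequently bounded
above and frequently bounded below, has distinct extended upper and lower limits, one of which is
infinite. -/
lemma limsup_ne_liminf_of_frequently {α : Type*} {l : Filter α} {q : α → ℝ}
    (hA : ∀ A : ℝ, ∃ᶠ x in l, A ≤ |q x|) (hC : ∃ C : ℝ, ∃ᶠ x in l, q x ≤ C)
    (hD : ∃ C : ℝ, ∃ᶠ x in l, C ≤ q x) :
    limsup (fun x => (q x : EReal)) l ≠ liminf (fun x => (q x : EReal)) l ∧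
      max (limsup (fun x => (q x : EReal)) l).abs (liminf (fun x => (q x : EReal)) l).abs = ⊤ := by
  obtain ⟨C, hC⟩ := hC
  obtain ⟨D, hD⟩ := hD
  have h1 : liminf (fun x => (q x : EReal)) l ≤ C :=
    liminf_le_of_frequently_le' (hC.mono fun x hx => EReal.coe_le_coe_iff.2 hx)
  have h2 : (D : EReal) ≤ limsup (fun x => (q x : EReal)) l :=
    le_limsup_of_frequently_le' (hD.mono fun x hx => EReal.coe_le_coe_iff.2 hx)
  -- Otherwise the values lie eventually between two reals `m` and `M`, against their unboundedness.
  have h3 : limsup (fun x => (q x : EReal)) l = ⊤ ∨ liminf (fun x => (q x : EReal)) l = ⊥ := by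
    by_contra! h
    obtain ⟨M, hM, -⟩ := EReal.lt_iff_exists_real_btwn.1 (lt_top_iff_ne_top.2 h.1)
    obtain ⟨m, -, hm⟩ := EReal.lt_iff_exists_real_btwn.1 (bot_lt_iff_ne_bot.2 h.2)
    have e1 := eventually_lt_of_limsup_lt hM
    have e2 := eventually_lt_of_lt_liminf hm
    obtain ⟨x, hx, hx1, hx2⟩ := ((hA (|M| + |m|)).and_eventually (e1.and e2)).exists
    rw [EReal.coe_lt_coe_iff] at hx1 hx2
    have := le_abs_self M
    have := neg_abs_le m
    have := abs_nonneg M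
    have := abs_nonneg m
    have : |q x| < |M| + |m| := by
      rw [abs_lt]
      constructor <;> linarith
    linarith
  rcases h3 with h3 | h3
  · refine ⟨?_, by rw [h3]; simp⟩
    rw [h3]
    intro h4
    rw [← h4] at h1
    exact absurd h1 (not_le.2 (EReal.coe_lt_top C))
  · refine ⟨?_, by rw [h3]; simp⟩
    rw [h3]
    intro h4
    rw [h4] at h2
    exact absurd h2 (not_le.2 (EReal.bot_lt_coe D))

lemma frequently_nhdsGT_unitInterval {t : unitInterval} (ht : t < 1) {P : ℝ → Prop}
    (h : ∀ δ, 0 < δ → ∃ x, (t : ℝ) < x ∧ x < t + δ ∧ P x) :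
    ∃ᶠ x : unitInterval in 𝓝[>] t, P x := by
  rw [Filter.Frequently, eventually_nhdsWithin_iff, Metric.eventually_nhds_iff]
  rintro ⟨ε, hε, hP⟩
  have ht' : (t : ℝ) < 1 := ht
  obtain ⟨x, hx1, hx2, hx⟩ := h (min ε (1 - t)) (lt_min hε (by linarith))
  have h1 := min_le_left ε (1 - t)
  have h2 := min_le_right ε (1 - (t : ℝ))
  refine hP (y := ⟨x, by linarith [t.2.1], by linarith⟩) ?_ hx1 hx
  rw [Subtype.dist_eq, Real.dist_eq, abs_of_pos (by linarith)]
  linarith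

lemma frequently_nhdsLT_unitInterval {t : unitInterval} (ht : 0 < t) {P : ℝ → Prop}
    (h : ∀ δ, 0 < δ → ∃ x, 1 - (t : ℝ) < x ∧ x < 1 - t + δ ∧ P (1 - x)) :
    ∃ᶠ x : unitInterval in 𝓝[<] t, P x := by
  rw [Filter.Frequently, eventually_nhdsWithin_iff, Metric.eventually_nhds_iff]
  rintro ⟨ε, hε, hP⟩
  have ht' : 0 < (t : ℝ) := ht
  obtain ⟨x, hx1, hx2, hx⟩ := h (min ε t) (lt_min hε ht')
  have h1 := min_le_left ε t
  have h2 := min_le_right ε (t : ℝ)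
  refine hP (y := ⟨1 - x, by linarith, by linarith [t.2.2]⟩) ?_
    (show 1 - x < t by linarith) hx
  rw [Subtype.dist_eq, Real.dist_eq, abs_of_neg (by linarith)]
  linarith

lemma RightOscillating.dini {f : ℝ → ℝ} {t : unitInterval} (ht : t < 1)
    (h : RightOscillating f t) :
    diniUpperRight (fun x => f x) t ≠ diniLowerRight (fun x => f x) t ∧
      max (diniUpperRight (fun x => f x) t).abs (diniLowerRight (fun x => f x) t).abs = ⊤ := by
  obtain ⟨h1, ⟨C, h2⟩, ⟨D, h3⟩⟩ := h
  refine limsup_ne_liminf_of_frequently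
    (q := fun x : unitInterval => (f x - f t) / ((x : ℝ) - (t : ℝ))) (fun A => ?_) ⟨C, ?_⟩ ⟨D, ?_⟩
  · refine frequently_nhdsGT_unitInterval (P := fun x => A ≤ |(f x - f t) / (x - t)|) ht
      fun δ hδ => ?_
    obtain ⟨x, hx1, hx2, hx⟩ := h1 A δ hδ
    refine ⟨x, hx1, hx2, ?_⟩
    have h0 : 0 < x - (t : ℝ) := by linarith
    rwa [abs_div, abs_of_pos h0, le_div_iff₀ h0]
  · refine frequently_nhdsGT_unitInterval (P := fun x => (f x - f t) / (x - t) ≤ C) ht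
      fun δ hδ => ?_
    obtain ⟨x, hx1, hx2, hx⟩ := h2 δ hδ
    exact ⟨x, hx1, hx2, by rwa [div_le_iff₀ (by linarith)]⟩
  · refine frequently_nhdsGT_unitInterval (P := fun x => D ≤ (f x - f t) / (x - t)) ht
      fun δ hδ => ?_
    obtain ⟨x, hx1, hx2, hx⟩ := h3 δ hδ
    exact ⟨x, hx1, hx2, by rwa [le_div_iff₀ (by linarith)]⟩

lemma RightOscillating.dini_left {f : ℝ → ℝ} {t : unitInterval} (ht : 0 < t)
    (h : RightOscillating (fun x => 1 - f (1 - x)) (1 - t)) :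
    diniUpperLeft (fun x => f x) t ≠ diniLowerLeft (fun x => f x) t ∧
      max (diniUpperLeft (fun x => f x) t).abs (diniLowerLeft (fun x => f x) t).abs = ⊤ := by
  obtain ⟨h1, ⟨C, h2⟩, ⟨D, h3⟩⟩ := h
  simp only [sub_sub_cancel, sub_sub_sub_cancel_left] at h1 h2 h3
  have hq : ∀ x, (f (1 - x) - f t) / (1 - x - t) = (f t - f (1 - x)) / (x - (1 - t)) := by
    intro x
    rw [← neg_sub (f t), show 1 - x - (t : ℝ) = -(x - (1 - t)) by ring, neg_div_neg_eq]
  refine limsup_ne_liminf_of_frequently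
    (q := fun x : unitInterval => (f x - f t) / ((x : ℝ) - (t : ℝ))) (fun A => ?_) ⟨C, ?_⟩ ⟨D, ?_⟩
  · refine frequently_nhdsLT_unitInterval (P := fun x => A ≤ |(f x - f t) / (x - t)|) ht
      fun δ hδ => ?_
    obtain ⟨x, hx1, hx2, hx⟩ := h1 A δ hδ
    refine ⟨x, hx1, hx2, ?_⟩
    have h0 : 0 < x - (1 - (t : ℝ)) := by linarith
    rwa [hq, abs_div, abs_of_pos h0, le_div_iff₀ h0]
  · refine frequently_nhdsLT_unitInterval (P := fun x => (f x - f t) / (x - t) ≤ C) ht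
      fun δ hδ => ?_
    obtain ⟨x, hx1, hx2, hx⟩ := h2 δ hδ
    exact ⟨x, hx1, hx2, by rwa [hq, div_le_iff₀ (by linarith)]⟩
  · refine frequently_nhdsLT_unitInterval (P := fun x => D ≤ (f x - f t) / (x - t)) ht
      fun δ hδ => ?_
    obtain ⟨x, hx1, hx2, hx⟩ := h3 δ hδ
    exact ⟨x, hx1, hx2, by rwa [hq, le_div_iff₀ (by linarith)]⟩

/-! ### Measure preservation and conclusion -/

/-- A measurable self-map of the unit interval whose distribution function is the identity preserves
Lebesgue measure. -/
lemma measurePreserving_of_subMeasure_eq {f : ℝ → ℝ} {F : unitInterval → unitInterval}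
    (hF : ∀ x, (F x : ℝ) = f x) (hc : Continuous f) (hcF : Continuous F)
    (h : ∀ y ∈ Icc (0 : ℝ) 1, SpikeSystem.subMeasure f y = y) :
    MeasurePreserving F volume volume := by
  refine ⟨hcF.measurable, ?_⟩
  have : IsProbabilityMeasure (Measure.map F volume) :=
    Measure.isProbabilityMeasure_map hcF.measurable.aemeasurable
  refine Measure.ext_of_Iic _ _ fun y => ?_
  rw [Measure.map_apply hcF.measurable measurableSet_Iic, unitInterval.volume_Iic,
    unitInterval.volume_apply]
  have hset : Subtype.val '' (F ⁻¹' Iic y) = {x | f x ≤ y} ∩ Icc 0 1 := by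
    ext x
    constructor
    · rintro ⟨x, hx, rfl⟩
      have hx' : (F x : ℝ) ≤ y := hx
      rw [hF] at hx'
      exact ⟨hx', x.2⟩
    · rintro ⟨hx, hx'⟩
      refine ⟨⟨x, hx'⟩, ?_, rfl⟩
      change (F ⟨x, hx'⟩ : ℝ) ≤ y
      rw [hF]
      exact hx
  have hm : MeasurableSet {x | f x ≤ y} := measurableSet_le hc.measurable measurable_const
  rw [hset]
  have h1 := h y y.2
  have h2 : (fun x => if f x ≤ (y : ℝ) then (1 : ℝ) else 0) =
      ({x | f x ≤ y} : Set ℝ).indicator 1 := by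
    ext x
    by_cases hx : f x ≤ y <;> simp [hx]
  rw [SpikeSystem.subMeasure, intervalIntegral.integral_of_le zero_le_one,
    ← integral_Icc_eq_integral_Ioc, h2, integral_indicator_one hm, measureReal_restrict_apply hm]
    at h1
  exact (ofReal_measureReal (measure_ne_top_of_subset inter_subset_right (by simp))).symm.trans
    (congrArg ENNReal.ofReal h1)

theorem theorem3 :
    ∃ f ∈ LebesguePreservingMaps,
      IsBesicovitchFunction (fun x => (f x : ℝ)) ∧ IsMorseFunction (fun x => (f x : ℝ)) := by
  obtain ⟨S⟩ := exists_spikeSystem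
  obtain ⟨f, hc, hf, hfix⟩ := S.exists_fixed
  have h := hf.isSpikeFunction hfix
  set F : unitInterval → unitInterval := fun x => ⟨f x, hf.mem x⟩
  have hcF : Continuous F := (hc.comp continuous_subtype_val).subtype_mk _
  have hcF' : Continuous fun x => (F x : ℝ) := continuous_subtype_val.comp hcF
  have hmp : MeasurePreserving F volume volume :=
    measurePreserving_of_subMeasure_eq (fun _ => rfl) hc hcF
      fun y hy => SpikeSystem.subMeasure_eq hf hfix hc hy
  have hR : ∀ t : unitInterval, t < 1 → RightOscillating f t := fun t ht =>
    h.rightOscillating t.2.1 ht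
  have hL : ∀ t : unitInterval, 0 < t → RightOscillating (fun x => 1 - f (1 - x)) (1 - t) :=
    fun t ht => h.rightOscillating_flip ht t.2.2
  refine ⟨F, ⟨hcF, fun y => ?_, fun A hA => (hmp.measure_preimage hA.nullMeasurableSet).symm⟩,
    ⟨hcF', fun t => ⟨fun ht => ((hR t ht.1).dini ht.1).1 ht.2,
      fun ht => ((hL t ht.1).dini_left ht.1).1 ht.2⟩⟩,
    ⟨hcF', fun t => ⟨fun ht => ((hR t ht).dini ht).2, fun ht => ((hL t ht).dini_left ht).2⟩⟩⟩
  obtain ⟨x, hx, hxy⟩ := intermediate_value_Icc zero_le_one hc.continuousOn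
    (show (y : ℝ) ∈ Icc (f 0) (f 1) by rw [h.f_zero, h.f_one]; exact y.2)
  exact ⟨⟨x, hx⟩, Subtype.ext hxy⟩
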